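/- Let $M$ be a compact smooth Riemannian manifold with (possibly empty) boundary, of dimension $n\ge 1$, with metric $g$, and let $G$ be a finite group acting on $M$ by isometries. Let $H$ and $H'$ be subgroups of $G$ that act freely on $M$ and that are almost conjugate (Gassmann equivalent) in $G$: every $a\in G$ has equally many conjugates in $H$ and in $H'$. Let $\rho\in L^\infty(\partial M)$ be nonnegative and $G$-invariant. Continue to denote by $g$ and $\rho$ the Riemannian metric and the boundary density induced on the quotient manifolds $H\backslash M$ and $H'\backslash M$. For a compact Riemannian manifold $(N,g)$ with boundary, $\alpha\in\mathbb R$ and $\rho\in L^\infty(\partial N)$, let $\operatorname{Stek}_\alpha(N,g,\rho)$ be the set of real numbers $\sigma$, counted with multiplicity, for which the problem $\Delta u=\alpha u$ in $N\smallsetminus\partial N$, $\partial_\nu u=\sigma\rho u$ on $\partial N$ (with $\Delta$ the nonnegative Laplacian and $\nu$ the outward unit normal) has a nontrivial weak solution, that is, some $0\ne u\in H^1(N)$ with $$\int_N\langle\nabla u,\nabla\varphi\rangle\,dvol_N=\alpha\int_N u\varphi\,dvol_N+\sigma\int_{\partial N}\rho\,u|_{\partial N}\,\varphi\,dvol_{\partial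 N}\qquad\text{for all }\varphi\in C^\infty(N),$$ where $u|_{\partial N}$ is the Sobolev trace; the multiplicity of $\sigma$ is the dimension of the space of weak solutions. Then $H\backslash M$ and $H'\backslash M$ have the same Dirichlet spectrum and the same Neumann spectrum (with multiplicities), and for every $\alpha\in\mathbb R$ that is not in the Dirichlet spectrum of $H\backslash M$ and $H'\backslash M$, $$\operatorname{Stek}_\alpha(H\backslash M,g,\rho)=\operatorname{Stek}_\alpha(H'\backslash M,g,\rho),$$ that is, the two Steklov spectra are equal as sets and each $\sigma\in\mathbb R$ has the same multiplicity in both. -/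

import Mathlib

set_option linter.unusedSectionVars false

open Set Filter Topology MeasureTheory Manifold Bundle
open scoped ContDiff ENNReal

section Quotient

variable {E : Type*} [NormedAddCommGroup E] [NormedSpace ℝ E] {H : Type*} [TopologicalSpace H]
  {I : ModelWithCorners ℝ E H}

/-- Every element of `Γ` acts on `M` by a smooth map. -/
class SmoothConstSMul (I : ModelWithCorners ℝ E H) (Γ M : Type*) [TopologicalSpace M]
    [ChartedSpace H M] [SMul Γ M] : Prop where
  contMDiff_const_smul : ∀ a : Γ, ContMDiff I I ∞ (fun x : M => a • x)

variable {M : Type*} [TopologicalSpace M] [ChartedSpace H M] [IsManifold I ∞ M] [T2Space M]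
  [CompactSpace M] {Γ : Type*} [Group Γ] [Finite Γ] [MulAction Γ M] [ContinuousConstSMul Γ M]
  [IsCancelSMul Γ M]

/-- The orbit map `M → Γ \ M`. -/
def orbitMap (Γ M : Type*) [Group Γ] [MulAction Γ M] (x : M) : MulAction.orbitRel.Quotient Γ M :=
  Quotient.mk (MulAction.orbitRel Γ M) x

theorem orbitMap_isLocalHomeomorph : IsLocalHomeomorph (orbitMap Γ M) :=
  isQuotientCoveringMap_quotientMk_of_properlyDiscontinuousSMul.isCoveringMap.isLocalHomeomorph

theorem orbitMap_smul (h : Γ) (x : M) : orbitMap Γ M (h • x) = orbitMap Γ M x :=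
  Quotient.sound ⟨h, rfl⟩

theorem orbitMap_eq_iff {x y : M} : orbitMap Γ M x = orbitMap Γ M y ↔ ∃ h : Γ, x = h • y := by
  refine ⟨fun hxy => ?_, ?_⟩
  · obtain ⟨h, hh⟩ := Quotient.exact hxy
    exact ⟨h, hh.symm⟩
  · rintro ⟨h, rfl⟩
    exact orbitMap_smul h y

theorem mem_atlas_quotient {e : OpenPartialHomeomorph (MulAction.orbitRel.Quotient Γ M) H} :
    e ∈ atlas H (MulAction.orbitRel.Quotient Γ M) →
     ∃ x : M, e = ((orbitMap_isLocalHomeomorph (Γ := Γ) (M := M)).localInverseAt x).trans (chartAt H x) := by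
  rintro ⟨q, rfl⟩
  exact ⟨_, rfl⟩

theorem eventually_localInverseAt_orbitMap (x m : M)
    (hm : orbitMap Γ M m ∈ ((orbitMap_isLocalHomeomorph (Γ := Γ)).localInverseAt x).source) :
    ∃ h : Γ, (orbitMap_isLocalHomeomorph (Γ := Γ)).localInverseAt x (orbitMap Γ M m) = h • m ∧
      ∀ᶠ y in 𝓝 m, (orbitMap_isLocalHomeomorph (Γ := Γ)).localInverseAt x (orbitMap Γ M y)
        = h • y := by
  set hf := orbitMap_isLocalHomeomorph (Γ := Γ) (M := M)
  obtain ⟨h, hh⟩ := orbitMap_eq_iff.1 (hf.apply_localInverseAt_of_mem hm)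
  refine ⟨h, hh, ?_⟩
  have hmem : h • m ∈ (hf.localInverseAt x).target := by
    rw [← hh]; exact (hf.localInverseAt x).map_source hm
  have : ∀ᶠ y in 𝓝 m, h • y ∈ (hf.localInverseAt x).target :=
    (continuous_const_smul h).continuousAt.eventually_mem
      ((hf.localInverseAt x).open_target.mem_nhds hmem)
  filter_upwards [this] with y hy
  have := (hf.localInverseAt x).right_inv hy
  rw [hf.localInverseAt_symm, orbitMap_smul] at this
  exact this

/-- The orbit space of a free smooth action of a finite group is a smooth manifold, with the charts
of `M` composed with local inverses of the orbit map. -/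
instance isManifold_orbitQuotient [SmoothConstSMul I Γ M] :
    IsManifold I ∞ (MulAction.orbitRel.Quotient Γ M) := by
  refine isManifold_of_contDiffOn I ∞ _ fun e e' he he' => ?_
  obtain ⟨x, rfl⟩ := mem_atlas_quotient he
  obtain ⟨x', rfl⟩ := mem_atlas_quotient he'
  set hf := orbitMap_isLocalHomeomorph (Γ := Γ) (M := M)
  rintro z ⟨hz, y, rfl⟩
  simp only [mfld_simps, mem_preimage, mem_inter_iff, I.left_inv] at hz
  obtain ⟨⟨hz1, hz2⟩, hz3, hz4⟩ := hz
  rw [hf.localInverseAt_symm] at hz3 hz4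
  obtain ⟨h, hh, hev⟩ := eventually_localInverseAt_orbitMap _ _ hz3
  rw [hh] at hz4
  have hsm := ((SmoothConstSMul.contMDiff_const_smul (I := I) (M := M) h)).contMDiffAt
    (x := (chartAt H x).symm y)
  have := ((contMDiffAt_iff_of_mem_source (I := I) (x := x) (y := x')
    ((chartAt H x).map_target hz1) hz4).1 hsm).2
  simp only [mfld_simps, hz1] at this
  refine ((this.mono inter_subset_right).congr_of_eventuallyEq ?_ ?_)
  · have hc : ContinuousAt (fun z : E => (chartAt H x).symm (I.symm z)) (I y) := by
      refine ContinuousAt.comp (g := (chartAt H x).symm) ?_ I.continuous_symm.continuousAt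
      rw [I.left_inv]
      exact (chartAt H x).continuousAt_symm hz1
    have hc' : Tendsto (fun z : E => (chartAt H x).symm (I.symm z)) (𝓝 (I y))
      (𝓝 ((chartAt H x).symm y)) := by
      simpa [ContinuousAt] using hc
    refine mem_nhdsWithin_of_mem_nhds ?_
    filter_upwards [hc'.eventually hev] with z hz
    simp only [mfld_simps, hf.localInverseAt_symm]
    rw [hz]
  · simp only [mfld_simps, hf.localInverseAt_symm]
    rw [hh]

/-- The local inverse of the orbit map through the point `x`. -/
noncomputable def localSection (Γ : Type*) [Group Γ] [Finite Γ] [MulAction Γ M]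
    [ContinuousConstSMul Γ M] [IsCancelSMul Γ M] (x : M) :
    OpenPartialHomeomorph (MulAction.orbitRel.Quotient Γ M) M :=
  (orbitMap_isLocalHomeomorph (Γ := Γ) (M := M)).localInverseAt x

theorem mem_localSection_source (x : M) : orbitMap Γ M x ∈ (localSection Γ x).source :=
  (orbitMap_isLocalHomeomorph (Γ := Γ) (M := M)).apply_self_mem_localInverseAt_source

theorem orbitMap_out (q : MulAction.orbitRel.Quotient Γ M) : orbitMap Γ M (Quotient.out q) = q :=
  Quotient.out_eq q

theorem mem_localSection_out (q : MulAction.orbitRel.Quotient Γ M) :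
    q ∈ (localSection Γ (Quotient.out q)).source := by
  have := mem_localSection_source (Γ := Γ) (Quotient.out q)
  rwa [orbitMap_out] at this

theorem orbitMap_localSection {x : M} {q : MulAction.orbitRel.Quotient Γ M}
    (hq : q ∈ (localSection Γ x).source) : orbitMap Γ M (localSection Γ x q) = q :=
  (orbitMap_isLocalHomeomorph (Γ := Γ) (M := M)).apply_localInverseAt_of_mem hq

/-- Two local sections of the orbit map differ locally by a fixed element of the group. -/
theorem localSection_eventually_eq {x x' : M} {q : MulAction.orbitRel.Quotient Γ M}
    (hq : q ∈ (localSection Γ x).source) (hq' : q ∈ (localSection Γ x').source) :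
    ∃ h : Γ, ∀ᶠ p in 𝓝 q, localSection Γ x p = h • localSection Γ x' p := by
  have hq1 : orbitMap Γ M (localSection Γ x' q) ∈ (localSection Γ x).source := by
    rwa [orbitMap_localSection hq']
  obtain ⟨h, -, hev⟩ := eventually_localInverseAt_orbitMap x (localSection Γ x' q) hq1
  refine ⟨h, ?_⟩
  have hc := (localSection Γ x').continuousAt hq'
  filter_upwards [hc.eventually hev, (localSection Γ x').open_source.mem_nhds hq'] with p hp hp'
  rw [orbitMap_localSection hp'] at hp
  exact hp

theorem localSection_contMDiffAt [SmoothConstSMul I Γ M] {x : M}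
    {q : MulAction.orbitRel.Quotient Γ M}
    (hq : q ∈ (localSection Γ x).source) : ContMDiffAt I I ∞ (localSection Γ x) q := by
  obtain ⟨x', hx'⟩ := mem_atlas_quotient (chart_mem_atlas H q)
  change _ = (localSection Γ x').trans _ at hx'
  have hq1 := mem_chart_source H q
  have hq2 : q ∈ (localSection Γ x').source := by
    rw [hx'] at hq1; exact hq1.1
  obtain ⟨h, hev⟩ := localSection_eventually_eq hq hq2
  have hsm : ContMDiffAt I I ∞ (localSection Γ x') q := by
    have h1 : ContMDiffAt I I ∞ (chartAt H q) q := contMDiffAt_of_mem_maximalAtlas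
      (IsManifold.chart_mem_maximalAtlas q) hq1
    have h3 : chartAt H q q ∈ (chartAt H x').target := by
      rw [hx'] at hq1 ⊢
      exact (chartAt H x').map_source hq1.2
    have h2 : ContMDiffAt I I ∞ (chartAt H x').symm (chartAt H q q) :=
      contMDiffAt_symm_of_mem_maximalAtlas (IsManifold.chart_mem_maximalAtlas x') h3
    refine (h2.comp q h1).congr_of_eventuallyEq ?_
    filter_upwards [(chartAt H q).open_source.mem_nhds hq1] with p hp
    rw [hx'] at hp
    simp only [Function.comp_apply, hx', OpenPartialHomeomorph.coe_trans]
    exact ((chartAt H x').left_inv hp.2).symm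
  exact ((SmoothConstSMul.contMDiff_const_smul (I := I) h).contMDiffAt.comp q hsm).congr_of_eventuallyEq hev

theorem orbitMap_contMDiff [SmoothConstSMul I Γ M] : ContMDiff I I ∞ (orbitMap Γ M) := by
  intro x
  obtain ⟨x', hx'⟩ := mem_atlas_quotient (chart_mem_atlas H (orbitMap Γ M x))
  change _ = (localSection Γ x').trans _ at hx'
  have hq1 := mem_chart_source H (orbitMap Γ M x)
  rw [hx'] at hq1
  obtain ⟨h, hh, -⟩ := eventually_localInverseAt_orbitMap x' x hq1.1
  change localSection Γ x' _ = _ at hh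
  have hmem : h • x ∈ (chartAt H x').source := by rw [← hh]; exact hq1.2
  have hmem' : h • x ∈ (localSection Γ x').target := by
    rw [← hh]; exact (localSection Γ x').map_source hq1.1
  have h1 : ContMDiffAt I I ∞ (chartAt H x') (h • x) := contMDiffAt_of_mem_maximalAtlas
      (IsManifold.chart_mem_maximalAtlas x') hmem
  have h0 := (SmoothConstSMul.contMDiff_const_smul (I := I) (M := M) h).contMDiffAt (x := x)
  have h3 : chartAt H x' (h • x) ∈ (chartAt H (orbitMap Γ M x)).target := by
    rw [hx']
    refine ⟨(chartAt H x').map_source hmem, ?_⟩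
    simp only [mem_preimage, (chartAt H x').left_inv hmem]
    exact hmem'
  have h2 := contMDiffAt_symm_of_mem_maximalAtlas (I := I) (n := ∞)
    (IsManifold.chart_mem_maximalAtlas (orbitMap Γ M x)) h3
  refine (h2.comp x (h1.comp x h0)).congr_of_eventuallyEq ?_
  filter_upwards [(continuous_const_smul h).continuousAt.eventually_mem
    ((chartAt H x').open_source.mem_nhds hmem)] with y hy
  simp only [Function.comp_apply, hx', OpenPartialHomeomorph.coe_trans_symm,
    (chartAt H x').left_inv hy]
  have : ((localSection Γ x').symm : M → _) = orbitMap Γ M :=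
    (orbitMap_isLocalHomeomorph (Γ := Γ) (M := M)).localInverseAt_symm x'
  rw [this, orbitMap_smul]

/-- The differential of the orbit map is a left inverse of the one of a local section. -/
theorem mfderiv_orbitMap_comp [SmoothConstSMul I Γ M] {x : M}
    {q : MulAction.orbitRel.Quotient Γ M} (hq : q ∈ (localSection Γ x).source)
    (v : TangentSpace I q) :
    mfderiv I I (orbitMap Γ M) (localSection Γ x q) (mfderiv I I (localSection Γ x) q v) = v := by
  have h1 := (orbitMap_contMDiff (I := I) (Γ := Γ)
    (localSection Γ x q)).mdifferentiableAt (by simp)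
  have h2 := (localSection_contMDiffAt (I := I) hq).mdifferentiableAt (by simp)
  have h3 := mfderiv_comp q h1 h2
  have h4 : orbitMap Γ M ∘ localSection Γ x =ᶠ[𝓝 q] id := by
    filter_upwards [(localSection Γ x).open_source.mem_nhds hq] with p hp
    exact orbitMap_localSection hp
  rw [h4.mfderiv_eq, mfderiv_id] at h3
  exact (congrArg (fun L => L v) h3).symm

/-- The group `Γ` acts on `(M, g)` by isometries: the differential of the action of each element
preserves the metric tensor. -/
def ActsByIsometries (g : ContMDiffRiemannianMetric I ∞ E (fun x : M => TangentSpace I x))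
    (Γ : Type*) [Group Γ] [MulAction Γ M] : Prop :=
  ∀ (a : Γ) (x : M) (v w : TangentSpace I x),
    g.inner (a • x) (mfderiv I I (fun y : M => a • y) x v) (mfderiv I I (fun y : M => a • y) x w) =
      g.inner x v w

variable (g : ContMDiffRiemannianMetric I ∞ E (fun x : M => TangentSpace I x))

/-- The pull-back of the metric `g` by the local section of the orbit map through `x`. -/
noncomputable def pulledInner (Γ : Type*) [Group Γ] [Finite Γ] [MulAction Γ M]
    [ContinuousConstSMul Γ M] [IsCancelSMul Γ M] (x : M) (q : MulAction.orbitRel.Quotient Γ M) :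
    TangentSpace I q →L[ℝ] TangentSpace I q →L[ℝ] ℝ :=
  (ContinuousLinearMap.precomp ℝ (mfderiv I I (localSection Γ x) q)) ∘L
    (g.inner (localSection Γ x q)) ∘L (mfderiv I I (localSection Γ x) q)

theorem pulledInner_apply (x : M) (q : MulAction.orbitRel.Quotient Γ M) (v w : TangentSpace I q) :
    pulledInner g Γ x q v w = g.inner (localSection Γ x q) (mfderiv I I (localSection Γ x) q v)
      (mfderiv I I (localSection Γ x) q w) := rfl

theorem pulledInner_eq [SmoothConstSMul I Γ M] (hg : ActsByIsometries g Γ) {x x' : M}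
    {q : MulAction.orbitRel.Quotient Γ M}
    (hq : q ∈ (localSection Γ x).source) (hq' : q ∈ (localSection Γ x').source) :
    pulledInner g Γ x q = pulledInner g Γ x' q := by
  obtain ⟨h, hev⟩ := localSection_eventually_eq hq hq'
  ext v w
  have h1 := (SmoothConstSMul.contMDiff_const_smul (I := I) h
    (localSection Γ x' q)).mdifferentiableAt (by simp)
  have h2 := (localSection_contMDiffAt (I := I) hq').mdifferentiableAt (by simp)
  have h3 := mfderiv_comp q h1 h2
  have h4 : localSection Γ x =ᶠ[𝓝 q] (fun y => h • y) ∘ localSection Γ x' := hev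
  rw [← h4.mfderiv_eq] at h3
  have := hg h (localSection Γ x' q) (mfderiv I I (localSection Γ x') q v)
    (mfderiv I I (localSection Γ x') q w)
  rw [pulledInner_apply, pulledInner_apply, ← this, h3, hev.self_of_nhds]
  rfl

theorem pulledInner_contMDiffAt [SmoothConstSMul I Γ M] {x : M}
    {q : MulAction.orbitRel.Quotient Γ M} (hq : q ∈ (localSection Γ x).source) :
    ContMDiffAt I (I.prod 𝓘(ℝ, E →L[ℝ] E →L[ℝ] ℝ)) ∞
      (fun p : MulAction.orbitRel.Quotient Γ M =>
        Bundle.TotalSpace.mk' (E →L[ℝ] E →L[ℝ] ℝ)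
          (E := fun p => TangentSpace I p →L[ℝ] TangentSpace I p →L[ℝ] ℝ) p
          (pulledInner g Γ x p)) q := by
  rw [contMDiffAt_hom_bundle]
  refine ⟨contMDiffAt_id, ?_⟩
  have hs := localSection_contMDiffAt (I := I) hq
  have hG := ((contMDiffAt_hom_bundle _).1 (g.contMDiff (localSection Γ x q))).2.comp q hs
  have hD : ContMDiffAt I 𝓘(ℝ, E →L[ℝ] E) ∞ (inTangentCoordinates I I id (localSection Γ x)
    (mfderiv I I (localSection Γ x)) q) q := hs.mfderiv_const (by simp)
  refine ((hD.clm_precomp (F₃ := ℝ)).clm_comp (hG.clm_comp hD)).congr_of_eventuallyEq ?_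
  have e1 := (trivializationAt E (TangentSpace I) q).open_baseSet.mem_nhds
    (FiberBundle.mem_baseSet_trivializationAt' q)
  have e2 := (localSection Γ x).continuousAt hq ((trivializationAt E (TangentSpace I)
    (localSection Γ x q)).open_baseSet.mem_nhds (FiberBundle.mem_baseSet_trivializationAt' _))
  filter_upwards [e1, e2] with p hp1 hp2
  ext v w
  have hv : ∀ u : E, (trivializationAt E (TangentSpace I) (localSection Γ x q)).symm
      (localSection Γ x p) (inTangentCoordinates I I id (localSection Γ x)
        (mfderiv I I (localSection Γ x)) q p u) = mfderiv I I (localSection Γ x) p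
          ((trivializationAt E (TangentSpace I) q).symm p u) := by
    intro u
    have hp2' : localSection Γ x p ∈ (trivializationAt E (TangentSpace I)
      (localSection Γ x q)).baseSet := hp2
    have h1 := ContinuousLinearMap.inCoordinates_eq (𝕜₁ := ℝ) (𝕜₂ := ℝ) (σ := RingHom.id ℝ)
      (ϕ := mfderiv I I (localSection Γ x) p) hp1 hp2'
    have h2 := congrArg (fun L : E →L[ℝ] E =>
      (trivializationAt E (TangentSpace I) (localSection Γ x q)).symm (localSection Γ x p) (L u)) h1
    refine h2.trans ?_
    exact ((trivializationAt E (TangentSpace I)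
      (localSection Γ x q)).continuousLinearEquivAt ℝ _ hp2').symm_apply_apply _
  have hL := inCoordinates_apply_eq₂ (𝕜 := ℝ) (F₁ := E) (F₂ := E) (F₃ := ℝ)
    (E₁ := fun p : MulAction.orbitRel.Quotient Γ M => TangentSpace I p)
    (E₂ := fun p : MulAction.orbitRel.Quotient Γ M => TangentSpace I p)
    (E₃ := fun _ => ℝ) (ϕ := pulledInner g Γ x p) (v := v) (w := w)
    hp1 hp1 (mem_univ _)
  have hR := inCoordinates_apply_eq₂ (𝕜 := ℝ) (F₁ := E) (F₂ := E) (F₃ := ℝ)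
    (E₁ := fun p : M => TangentSpace I p)
    (E₂ := fun p : M => TangentSpace I p)
    (E₃ := fun _ => ℝ) (ϕ := g.inner (localSection Γ x p))
    (v := inTangentCoordinates I I id (localSection Γ x)
        (mfderiv I I (localSection Γ x)) q p v)
    (w := inTangentCoordinates I I id (localSection Γ x)
        (mfderiv I I (localSection Γ x)) q p w)
    hp2 hp2 (mem_univ _)
  rw [hv, hv] at hR
  refine hL.trans (Eq.trans ?_ hR.symm)
  simp [pulledInner_apply]

/-- The Riemannian metric induced by `g` on the orbit manifold `Γ \ M`: at each point it is the
pull-back of `g` by a local inverse of the orbit map. -/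
noncomputable def quotientMetric (Γ : Type*) [Group Γ] [Finite Γ] [MulAction Γ M]
    [ContinuousConstSMul Γ M] [IsCancelSMul Γ M] [SmoothConstSMul I Γ M]
    (hg : ActsByIsometries g Γ) :
    ContMDiffRiemannianMetric I ∞ E
      (fun q : MulAction.orbitRel.Quotient Γ M => TangentSpace I q) where
  inner q := pulledInner g Γ (Quotient.out q) q
  symm q v w := g.symm _ _ _
  pos q v hv := by
    rw [pulledInner_apply]
    refine g.pos _ _ fun h0 => hv ?_
    have := mfderiv_orbitMap_comp (I := I) (mem_localSection_out q) v
    rw [h0, map_zero] at this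
    exact this.symm
  isVonNBounded q := by
    have h1 := (g.isVonNBounded (localSection Γ (Quotient.out q) q)).image
      (mfderiv I I (orbitMap Γ M) (localSection Γ (Quotient.out q) q))
    refine h1.subset fun v hv => ?_
    exact ⟨mfderiv I I (localSection Γ (Quotient.out q)) q v, hv,
      mfderiv_orbitMap_comp (I := I) (mem_localSection_out q) v⟩
  contMDiff q := by
    refine (pulledInner_contMDiffAt g (mem_localSection_out q)).congr_of_eventuallyEq ?_
    filter_upwards [(localSection Γ (Quotient.out q)).open_source.mem_nhds
      (mem_localSection_out q)] with p hp
    rw [pulledInner_eq g hg (mem_localSection_out p) hp]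

/-- The orbit map is a local isometry onto the quotient manifold. -/
theorem quotientMetric_pullback [SmoothConstSMul I Γ M] (hg : ActsByIsometries g Γ) (x : M)
    (v w : TangentSpace I x) :
    (quotientMetric g Γ hg).inner (orbitMap Γ M x) (mfderiv I I (orbitMap Γ M) x v)
      (mfderiv I I (orbitMap Γ M) x w) = g.inner x v w := by
  have hs := mem_localSection_source (Γ := Γ) x
  have hx : localSection Γ x (orbitMap Γ M x) = x :=
    (orbitMap_isLocalHomeomorph (Γ := Γ) (M := M)).localInverseAt_apply_self
  have h1 := (orbitMap_contMDiff (I := I) (Γ := Γ) x).mdifferentiableAt (by simp)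
  have h2 := (localSection_contMDiffAt (I := I) hs).mdifferentiableAt (by simp)
  have h3 := mfderiv_comp x h2 h1
  have h4 : localSection Γ x ∘ orbitMap Γ M =ᶠ[𝓝 x] id := by
    obtain ⟨h, hh, hev⟩ := eventually_localInverseAt_orbitMap x x hs
    have : h = 1 := IsCancelSMul.eq_one_of_smul (hh.symm.trans hx)
    filter_upwards [hev] with y hy
    rw [this, one_smul] at hy
    exact hy
  rw [h4.mfderiv_eq, mfderiv_id] at h3
  have h5 : ∀ u, mfderiv I I (localSection Γ x) (orbitMap Γ M x)
      (mfderiv I I (orbitMap Γ M) x u) = u := fun u => (congrArg (fun L => L u) h3).symm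
  change pulledInner g Γ _ _ _ _ = _
  rw [pulledInner_eq g hg (mem_localSection_out _) hs, pulledInner_apply]
  have key : ∀ (y : M) (_ : y = x) (a b : E), a = v → b = w →
      (show E →L[ℝ] E →L[ℝ] ℝ from g.inner y) a b = g.inner x v w := by
    rintro y rfl a b rfl rfl
    rfl
  exact key _ hx _ _ (h5 v) (h5 w)

theorem ActsByIsometries.subgroup {G : Type*} [Group G] [MulAction G M]
    {g : ContMDiffRiemannianMetric I ∞ E (fun x : M => TangentSpace I x)}
    (hg : ActsByIsometries g G) (S : Subgroup G) : ActsByIsometries g S :=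
  fun a x v w => hg (a : G) x v w

instance continuousConstSMul_subgroup {G : Type*} [Group G] [MulAction G M] [ContinuousConstSMul G M] (S : Subgroup G) :
    ContinuousConstSMul S M :=
  ⟨fun a => continuous_const_smul (a : G)⟩

instance smoothConstSMul_subgroup {G : Type*} [Group G] [MulAction G M] [SmoothConstSMul I G M] (S : Subgroup G) :
    SmoothConstSMul I S M :=
  ⟨fun a => SmoothConstSMul.contMDiff_const_smul (a : G)⟩

/-- The function on the orbit space induced by an invariant function on `M`: its value at an orbit
is the value of `ρ` at a point of the orbit. -/
noncomputable def inducedFunction (Γ : Type*) [Group Γ] [MulAction Γ M] (ρ : M → ℝ)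
    (q : MulAction.orbitRel.Quotient Γ M) : ℝ :=
  ρ (Quotient.out q)

end Quotient

/-- Two subgroups of `G` are almost conjugate (Gassmann equivalent) if every element of `G` has
equally many conjugates in the one and in the other. -/
def AlmostConjugate {G : Type*} [Group G] (H H' : Subgroup G) : Prop :=
  ∀ a : G, {b : G | IsConj a b ∧ b ∈ H}.ncard = {b : G | IsConj a b ∧ b ∈ H'}.ncard

section Spectra

variable {n : ℕ} [NeZero n] {M : Type*} [TopologicalSpace M] [T2Space M] [CompactSpace M]
  [ChartedSpace (EuclideanHalfSpace n) M] [IsManifold (𝓡∂ n) ∞ M]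

/-- Smooth Riemannian metrics on the `n`-dimensional manifold with boundary `M`. -/
abbrev RiemMetric (n : ℕ) [NeZero n] (M : Type*) [TopologicalSpace M]
    [ChartedSpace (EuclideanHalfSpace n) M] [IsManifold (𝓡∂ n) ∞ M] :=
  ContMDiffRiemannianMetric (𝓡∂ n) ∞ (EuclideanSpace ℝ (Fin n))
    (fun x : M => TangentSpace (𝓡∂ n) x)

/-- Smooth real functions on `M` (smooth up to the boundary). -/
abbrev SmoothFunction (n : ℕ) [NeZero n] (M : Type*) [TopologicalSpace M]
    [ChartedSpace (EuclideanHalfSpace n) M] :=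
  C^∞⟮𝓡∂ n, M; 𝓘(ℝ, ℝ), ℝ⟯

/-- The `d`-dimensional Hausdorff measure of the Riemannian distance of `g`, normalized to agree
with Lebesgue measure on `d`-dimensional Euclidean space. -/
noncomputable def riemannianHausdorffMeasure (g : RiemMetric n M) (d : ℕ) :
    @Measure M (borel M) :=
  letI : RiemannianBundle (fun x : M => TangentSpace (𝓡∂ n) x) := ⟨g.toRiemannianMetric⟩
  haveI : IsContinuousRiemannianBundle (EuclideanSpace ℝ (Fin n))
      (fun x : M => TangentSpace (𝓡∂ n) x) := ⟨g.inner, g.contMDiff.continuous, fun _ _ _ => rfl⟩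
  letI : EMetricSpace M := EMetricSpace.ofRiemannianMetric (𝓡∂ n) M
  letI : MeasurableSpace M := borel M
  haveI : BorelSpace M := ⟨rfl⟩
  μHE[d]

/-- The Riemannian volume measure of `(M, g)`: it is the normalized Hausdorff measure in the
dimension of `M`. -/
noncomputable def volumeMeasure (g : RiemMetric n M) : @Measure M (borel M) :=
  riemannianHausdorffMeasure g n

/-- The Riemannian volume measure of `∂M`, regarded as a measure on `M` that is carried by `∂M`:
it is the normalized `(n - 1)`-dimensional Hausdorff measure, restricted to `∂M`. -/
noncomputable def boundaryMeasure (g : RiemMetric n M) : @Measure M (borel M) :=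
  (riemannianHausdorffMeasure g (n - 1)).restrict ((𝓡∂ n).boundary M)

/-- The Riemannian gradient. -/
noncomputable def riemannianGradient (g : RiemMetric n M) (f : M → ℝ) (x : M) :
    TangentSpace (𝓡∂ n) x :=
  letI : RiemannianBundle (fun x : M => TangentSpace (𝓡∂ n) x) := ⟨g.toRiemannianMetric⟩
  haveI : FiniteDimensional ℝ (TangentSpace (𝓡∂ n) x) :=
    inferInstanceAs (FiniteDimensional ℝ (EuclideanSpace ℝ (Fin n)))
  haveI : CompleteSpace (TangentSpace (𝓡∂ n) x) := FiniteDimensional.complete ℝ _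
  (InnerProductSpace.toDual ℝ (TangentSpace (𝓡∂ n) x)).symm (mfderiv (𝓡∂ n) 𝓘(ℝ, ℝ) f x)

theorem inner_riemannianGradient (g : RiemMetric n M) (f : M → ℝ) (x : M)
    (v : TangentSpace (𝓡∂ n) x) :
    g.inner x (riemannianGradient g f x) v = mfderiv (𝓡∂ n) 𝓘(ℝ, ℝ) f x v := by
  let : RiemannianBundle (fun x : M => TangentSpace (𝓡∂ n) x) := ⟨g.toRiemannianMetric⟩
  have : FiniteDimensional ℝ (TangentSpace (𝓡∂ n) x) :=
    inferInstanceAs (FiniteDimensional ℝ (EuclideanSpace ℝ (Fin n)))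
  have : CompleteSpace (TangentSpace (𝓡∂ n) x) := FiniteDimensional.complete ℝ _
  exact InnerProductSpace.toDual_symm_apply (𝕜 := ℝ) (x := v)
    (y := (mfderiv (𝓡∂ n) 𝓘(ℝ, ℝ) f x : StrongDual ℝ (TangentSpace (𝓡∂ n) x)))

/-- The function `⟨∇f, ∇φ⟩`. -/
noncomputable def gradInner (g : RiemMetric n M) (f φ : M → ℝ) (x : M) : ℝ :=
  g.inner x (riemannianGradient g f x) (riemannianGradient g φ x)

/-- The space `L²(M)`. -/
noncomputable abbrev L2 (g : RiemMetric n M) := Lp ℝ 2 (volumeMeasure g)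

/-- The space `L²(∂M)`. -/
noncomputable abbrev L2Boundary (g : RiemMetric n M) := Lp ℝ 2 (boundaryMeasure g)

/-- The sequence `f` of smooth functions converges to `u` in the Sobolev space `H¹(M)`: it
converges to `u` in `L²(M)` and it is a Cauchy sequence for the Dirichlet energy. -/
structure TendstoH1 (g : RiemMetric n M) (f : ℕ → SmoothFunction n M) (u : L2 g) : Prop where
  tendsto_L2 : Tendsto (fun k => eLpNorm (fun x => f k x - u x) 2 (volumeMeasure g)) atTop (𝓝 0)
  cauchy : Tendsto (fun p : ℕ × ℕ => ∫⁻ x, ENNReal.ofReal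
    (gradInner g (f p.1 - f p.2) (f p.1 - f p.2) x) ∂(volumeMeasure g)) atTop (𝓝 0)

/-- `u` is in `H¹(M)`, the completion of the smooth functions in the Sobolev norm. -/
def MemH1 (g : RiemMetric n M) (u : L2 g) : Prop :=
  ∃ f : ℕ → SmoothFunction n M, TendstoH1 g f u

/-- `u` is in `H¹₀(M)`, the closure in `H¹(M)` of the smooth functions with (compact) support in
the interior of `M`. -/
def MemH10 (g : RiemMetric n M) (u : L2 g) : Prop :=
  ∃ f : ℕ → SmoothFunction n M, (∀ k, tsupport (f k) ⊆ (𝓡∂ n).interior M) ∧ TendstoH1 g f u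

/-- `u` is in `H¹(M)` and `w ∈ L²(∂M)` is its Sobolev trace: the trace operator is the extension by
continuity of the restriction of smooth functions to `∂M`. -/
def HasTrace (g : RiemMetric n M) (u : L2 g) (w : L2Boundary g) : Prop :=
  ∃ f : ℕ → SmoothFunction n M, TendstoH1 g f u ∧
    Tendsto (fun k => eLpNorm (fun x => f k x - w x) 2 (boundaryMeasure g)) atTop (𝓝 0)

/-- `u` is in `H¹(M)` and `∫_M ⟨∇u, ∇φ⟩ = d`, where the left-hand side is extended by continuity
from smooth `u` to all `u` in `H¹(M)`. -/
def HasDirichletForm (g : RiemMetric n M) (u : L2 g) (φ : SmoothFunction n M) (d : ℝ) : Prop :=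
  ∃ f : ℕ → SmoothFunction n M, TendstoH1 g f u ∧
    Tendsto (fun k => ∫ x, gradInner g (f k) φ x ∂(volumeMeasure g)) atTop (𝓝 d)

/-- `u ∈ H¹(M)` is a weak solution of `Δu = α u` in `M` (with the nonnegative Laplacian) and
`∂_ν u = σ ρ u` on `∂M` (with the outward normal derivative):
`∫_M ⟨∇u, ∇φ⟩ = α ∫_M u φ + σ ∫_{∂M} ρ u φ` for all smooth `φ`, where `u` in the boundary integral
is the Sobolev trace. -/
def IsSteklovSolution (g : RiemMetric n M) (α : ℝ) (ρ : M → ℝ) (σ : ℝ) (u : L2 g) : Prop :=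
  ∃ w : L2Boundary g, HasTrace g u w ∧ ∀ φ : SmoothFunction n M, HasDirichletForm g u φ
    (α * (∫ x, u x * φ x ∂(volumeMeasure g)) + σ * ∫ x, ρ x * w x * φ x ∂(boundaryMeasure g))

/-- `u ∈ H¹₀(M)` is a weak solution of `Δu = μ u` in `M`, `u = 0` on `∂M`. -/
def IsDirichletSolution (g : RiemMetric n M) (μ : ℝ) (u : L2 g) : Prop :=
  MemH10 g u ∧ ∀ φ : SmoothFunction n M, tsupport φ ⊆ (𝓡∂ n).interior M →
    HasDirichletForm g u φ (μ * ∫ x, u x * φ x ∂(volumeMeasure g))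

/-- `u ∈ H¹(M)` is a weak solution of `Δu = μ u` in `M`, `∂_ν u = 0` on `∂M`. -/
def IsNeumannSolution (g : RiemMetric n M) (μ : ℝ) (u : L2 g) : Prop :=
  MemH1 g u ∧ ∀ φ : SmoothFunction n M,
    HasDirichletForm g u φ (μ * ∫ x, u x * φ x ∂(volumeMeasure g))

/-- The Steklov spectrum `Stek_α(M, g, ρ)`. -/
def steklovSpectrum (g : RiemMetric n M) (α : ℝ) (ρ : M → ℝ) : Set ℝ :=
  {σ | ∃ u : L2 g, u ≠ 0 ∧ IsSteklovSolution g α ρ σ u}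

/-- The multiplicity of `σ` in `Stek_α(M, g, ρ)`, that is, the dimension of the space of solutions
(the solutions form a linear space, so they are all of their span). -/
noncomputable def steklovMultiplicity (g : RiemMetric n M) (α : ℝ) (ρ : M → ℝ) (σ : ℝ) :
    Cardinal :=
  Module.rank ℝ (Submodule.span ℝ {u : L2 g | IsSteklovSolution g α ρ σ u})

/-- The spectrum of the Dirichlet Laplacian. -/
def dirichletSpectrum (g : RiemMetric n M) : Set ℝ :=
  {μ | ∃ u : L2 g, u ≠ 0 ∧ IsDirichletSolution g μ u}

/-- The multiplicity of `μ` as a Dirichlet eigenvalue. -/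
noncomputable def dirichletMultiplicity (g : RiemMetric n M) (μ : ℝ) : Cardinal :=
  Module.rank ℝ (Submodule.span ℝ {u : L2 g | IsDirichletSolution g μ u})

/-- The spectrum of the Neumann Laplacian. -/
def neumannSpectrum (g : RiemMetric n M) : Set ℝ :=
  {μ | ∃ u : L2 g, u ≠ 0 ∧ IsNeumannSolution g μ u}

/-- The multiplicity of `μ` as a Neumann eigenvalue. -/
noncomputable def neumannMultiplicity (g : RiemMetric n M) (μ : ℝ) : Cardinal :=
  Module.rank ℝ (Submodule.span ℝ {u : L2 g | IsNeumannSolution g μ u})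

end Spectra

/-!
Weak solutions on `Γ \ M` are the same thing as `Γ`-invariant weak solutions on `M`. Indeed the
orbit map `p : M → Γ \ M` is smooth, preserves the metric and the boundary, and is a covering with
`|Γ|` sheets, so that `∫_M f ∘ p = |Γ| ∫_{Γ \ M} f`, both for the volume and for the boundary
measure. A weak solution on `Γ \ M` can be tested on `M` against a function `φ` by testing it on
`Γ \ M` against the average of `φ` over the orbits, and a sequence of smooth functions on `M` that
approximates an invariant function descends to `Γ \ M` after it has been averaged. This gives
`pullback_mem_eigenspace_iff` and `pullback_mem_steklovSpace_iff`: a function `v` on `Γ \ M` is a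
solution if and only if `v ∘ p` is a solution on `M`.

Fix an eigenvalue, or `α` and `σ`. The solutions on `M` form a subspace `V` of `L²(M)`, which the
isometries in `G` map to itself. Hence `V` is a real representation of the finite group `G`, and for
a subgroup `H` that acts freely, the space of solutions on `H \ M` is isomorphic to the space `V^H`
of the vectors fixed by `H` (`rank_comap_pullback`). If `H` and `H'` are almost conjugate, then
`V^H` and `V^{H'}` have equal dimensions (`rank_fixedVectors_eq`): for a finite dimensional `V` the
dimension of `V^H` is the average over `H` of the character of `V`, which is a class function, and
in general `V` is a direct sum of finite dimensional representations. So multiplicities agree on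
the two quotients, and the spectra are the sets of numbers of nonzero multiplicity. The argument
uses neither ellipticity nor the compactness of any resolvent.

What is left is to relate the objects on `M` and on `Γ \ M`.
* `exists_isFiniteMeasureQuotient`: the volume and boundary measures of `M` are the lifts of those
  of `Γ \ M`. The measures are Hausdorff measures of Riemannian distances; the orbit map does not
  increase distances, and neither do its local sections on small enough sets, because short paths
  stay where the section is defined. Preimages of small sets are therefore `|Γ|` disjoint copies
  with the same Hausdorff measure.
* `isFiniteMeasure_volumeMeasure`, `isFiniteMeasure_boundaryMeasure` and `continuous_gradInner`
  provide the integrability of the integrands in the weak formulations. The measures are finite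
  because the inverses of charts are locally Lipschitz for the Riemannian distance.
-/

/-! ### Fixed vectors of almost conjugate subgroups -/

section GassmannInvariants

variable {G : Type*} [Group G]

/-- Class functions have equal sums over almost conjugate subgroups. -/
theorem AlmostConjugate.sum_eq [Fintype G] {S S' : Subgroup G} (hSS' : AlmostConjugate S S')
    [Fintype S] [Fintype S'] (χ : G → ℝ) (hχ : ∀ a b, IsConj a b → χ a = χ b) :
    ∑ a : S, χ a = ∑ a : S', χ a := by
  classical
  -- summing over conjugacy classes `c`, each contributes the value of `χ` on `c` times the number
  -- of elements of `c` in the subgroup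
  choose rep hrep using fun c : ConjClasses G => c.exists_rep
  have key : ∀ T : Subgroup G, ∀ [Fintype T], ∑ a : T, χ a =
      ∑ c : ConjClasses G, ({b : G | IsConj (rep c) b ∧ b ∈ T}.ncard : ℝ) * χ (rep c) := by
    intro T _
    rw [← Finset.sum_fiberwise (s := (Finset.univ : Finset T))
      (g := fun a : T => ConjClasses.mk (a : G))]
    refine Finset.sum_congr rfl fun c _ => ?_
    have h1 : ∀ a ∈ Finset.univ.filter (fun a : T => ConjClasses.mk (a : G) = c),
        χ a = χ (rep c) := by
      intro a ha
      rw [Finset.mem_filter, ← hrep c] at ha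
      exact hχ _ _ (ConjClasses.mk_eq_mk_iff_isConj.1 ha.2)
    rw [Finset.sum_congr rfl h1, Finset.sum_const, nsmul_eq_mul]
    congr 2
    rw [← Set.ncard_coe_finset, ← Set.ncard_image_of_injective _ Subtype.val_injective]
    congr 1
    ext b
    simp only [Finset.coe_filter, Finset.mem_univ, true_and, Set.mem_image, Set.mem_ofPred_eq,
      Subtype.exists, exists_and_left, exists_prop, exists_eq_right_right]
    rw [← ConjClasses.mk_eq_mk_iff_isConj, hrep c, eq_comm, and_comm]
  rw [key S, key S']
  simp_rw [hSS' _]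

variable {W : Type*} [AddCommGroup W] [Module ℝ W]

/-- The vectors fixed by the elements of a subgroup. -/
def fixedVectors (θ : Representation ℝ G W) (S : Subgroup G) : Submodule ℝ W where
  carrier := {w | ∀ a ∈ S, θ a w = w}
  add_mem' hv hw a ha := by rw [map_add, hv a ha, hw a ha]
  zero_mem' a _ := map_zero _
  smul_mem' c w hw a ha := by rw [map_smul, hw a ha]

theorem mem_fixedVectors {θ : Representation ℝ G W} {S : Subgroup G} {w : W} :
    w ∈ fixedVectors θ S ↔ ∀ a ∈ S, θ a w = w := Iff.rfl

/-- The dimension of the fixed space of a subgroup is the average of the character over it. -/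
theorem finrank_fixedVectors_eq [Finite G] [FiniteDimensional ℝ W] (θ : Representation ℝ G W)
    {S S' : Subgroup G} (hSS' : AlmostConjugate S S') :
    Module.finrank ℝ (fixedVectors θ S) = Module.finrank ℝ (fixedVectors θ S') := by
  classical
  have := Fintype.ofFinite G
  have key : ∀ T : Subgroup G, (Module.finrank ℝ (fixedVectors θ T) : ℝ) =
      (∑ _a : T, (1 : ℝ))⁻¹ * ∑ a : T, θ.character a := by
    intro T
    have : Invertible (Nat.card T : ℝ) := invertibleOfNonzero (by simp)
    have h := Representation.card_inv_mul_sum_char_eq_finrank (θ.comp T.subtype)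
    have e : fixedVectors θ T = Representation.invariants (θ.comp T.subtype) := by
      ext w
      simp [mem_fixedVectors, Representation.mem_invariants]
    rw [e, ← h]
    simp [Representation.character]
  have hc : ∀ a b, IsConj a b → θ.character a = θ.character b := by
    intro a b hab
    obtain ⟨c, rfl⟩ := isConj_iff.1 hab
    exact (θ.char_conj a c).symm
  have := key S
  rw [hSS'.sum_eq _ hc, hSS'.sum_eq (fun _ => 1) (fun _ _ _ => rfl), ← key S'] at this
  exact_mod_cast this

/-- Almost conjugate subgroups of a finite group have fixed spaces of the same dimension in each
real representation. For a finite dimensional one, the dimensions are averages of the character;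
the general one is a direct sum of finite dimensional ones. -/
theorem rank_fixedVectors_eq [Finite G] (θ : Representation ℝ G W)
    {S S' : Subgroup G} (hSS' : AlmostConjugate S S') :
    Module.rank ℝ (fixedVectors θ S) = Module.rank ℝ (fixedVectors θ S') := by
  classical
  have : NeZero (Nat.card G : ℝ) := ⟨Nat.cast_ne_zero.2 Nat.card_pos.ne'⟩
  obtain ⟨s, e, -, hs⟩ := IsSemisimpleModule.exists_linearEquiv_dfinsupp (MonoidAlgebra ℝ G)
    θ.asModule
  have hfin : ∀ m : s, Module.Finite ℝ m.1 := fun m => by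
    have := hs m
    have : Module.Finite ℝ (MonoidAlgebra ℝ G) := inferInstance
    exact Module.Finite.trans (MonoidAlgebra ℝ G) m.1
  let τ : ∀ m : s, Representation ℝ G m.1 := fun m => Representation.ofModule' m.1
  have key : ∀ T : Subgroup G, Module.rank ℝ (fixedVectors θ T) =
      Cardinal.sum fun m : s => Module.rank ℝ (fixedVectors (τ m) T) := by
    intro T
    let f : (Π₀ m : s, fixedVectors (τ m) T) →ₗ[ℝ] Π₀ m : s, m.1 :=
      DFinsupp.mapRange.linearMap fun m => (fixedVectors (τ m) T).subtype
    have hf : Function.Injective f :=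
      (DFinsupp.mapRange_injective _ fun _ => map_zero _).2 fun m => Subtype.val_injective
    let e' : W ≃ₗ[ℝ] Π₀ m : s, m.1 := θ.asModuleEquiv.symm.trans (e.restrictScalars ℝ)
    have he' : ∀ (a : G) (w : W) (m : s), e' (θ a w) m = τ m a (e' w m) := by
      intro a w m
      change e (θ.asModuleEquiv.symm (θ a w)) m =
        MonoidAlgebra.of ℝ G a • e (θ.asModuleEquiv.symm w) m
      rw [Representation.asModuleEquiv_symm_map_rho, map_smul]
      rfl
    have hr : (fixedVectors θ T).map e'.toLinearMap = LinearMap.range f := by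
      ext z
      simp only [Submodule.mem_map, LinearMap.mem_range]
      constructor
      · rintro ⟨w, hw, rfl⟩
        refine ⟨DFinsupp.mk (e' w).support fun m => ⟨e' w m, fun a ha => ?_⟩, ?_⟩
        · rw [← he', hw a ha]
        · ext1 m
          by_cases hm : m ∈ (e' w).support
          · simp [f, hm]
          · simp [f, hm, DFinsupp.notMem_support_iff.1 hm]
      · rintro ⟨y, rfl⟩
        refine ⟨e'.symm (f y), fun a ha => e'.injective ?_, by simp⟩
        ext1 m
        rw [he']
        simp only [LinearEquiv.apply_symm_apply]
        exact (y m).2 a ha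
    rw [← e'.rank_map_eq (fixedVectors θ T), hr, rank_range_of_injective f hf]
    exact rank_directSum ℝ fun m : s => fixedVectors (τ m) T
  rw [key S, key S']
  congr 1
  ext1 m
  rw [← Module.finrank_eq_rank, ← Module.finrank_eq_rank, finrank_fixedVectors_eq _ hSS']

end GassmannInvariants

/-! ### Quotients of measure spaces by finite groups -/

section FiniteQuotient

variable {X Y Γ : Type*} [Group Γ] [MulAction Γ X]

/-- The average of a function over the orbits of a finite group. -/
noncomputable def orbitAverage (Γ : Type*) {X : Type*} [Group Γ] [Fintype Γ] [MulAction Γ X]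
    (f : X → ℝ) (x : X) : ℝ :=
  (Fintype.card Γ : ℝ)⁻¹ * ∑ a : Γ, f (a • x)

section

variable [Fintype Γ]

theorem orbitAverage_smul_point (f : X → ℝ) (b : Γ) (x : X) :
    orbitAverage Γ f (b • x) = orbitAverage Γ f x := by
  unfold orbitAverage
  congr 1
  refine Fintype.sum_equiv (Equiv.mulRight b) _ _ fun a => ?_
  simp [mul_smul]

theorem orbitAverage_of_invariant {f : X → ℝ} {x : X} (hf : ∀ a : Γ, f (a • x) = f x) :
    orbitAverage Γ f x = f x := by
  simp [orbitAverage, hf]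

end

/-- The measurable space `Y` is the quotient of `X` by the measure preserving action of the finite
group `Γ`, with quotient map `p` and a measurable section `s`, and `μ` is the lift of `ν`: its image
is `|Γ|` times `ν`, as for a free action. -/
structure IsFiniteMeasureQuotient {mX : MeasurableSpace X} {mY : MeasurableSpace Y}
    (Γ : Type*) [Group Γ] [MulAction Γ X] (p : X → Y) (s : Y → X) (μ : Measure X)
    (ν : Measure Y) : Prop where
  measurable_proj : Measurable p
  measurable_section : Measurable s
  proj_section : ∀ y, p (s y) = y
  proj_smul : ∀ (a : Γ) x, p (a • x) = p x
  exists_smul : ∀ x x', p x = p x' → ∃ a : Γ, x = a • x'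
  measurePreserving_smul : ∀ a : Γ, MeasurePreserving (fun x : X => a • x) μ μ
  map_proj : Measure.map p μ = (Nat.card Γ : ℝ≥0∞) • ν

namespace IsFiniteMeasureQuotient

variable {mX : MeasurableSpace X} {mY : MeasurableSpace Y} {p : X → Y} {s : Y → X}
  {μ : Measure X} {ν : Measure Y} [Finite Γ]

theorem card_ne_zero (Γ : Type*) [Group Γ] [Finite Γ] : (Nat.card Γ : ℝ≥0∞) ≠ 0 :=
  Nat.cast_ne_zero.2 Nat.card_pos.ne'

theorem quasiMeasurePreserving_proj (h : IsFiniteMeasureQuotient Γ p s μ ν) :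
    Measure.QuasiMeasurePreserving p μ ν :=
  ⟨h.measurable_proj, by rw [h.map_proj]; exact Measure.smul_absolutelyContinuous⟩

/-- The preimage of a null set `N` by the section is a null set, since its preimage in `X` is
covered by the translates of `N`. -/
theorem quasiMeasurePreserving_section (h : IsFiniteMeasureQuotient Γ p s μ ν) :
    Measure.QuasiMeasurePreserving s ν μ := by
  refine ⟨h.measurable_section, Measure.AbsolutelyContinuous.mk fun N hN hμ => ?_⟩
  rw [Measure.map_apply h.measurable_section hN]
  have h1 : (Nat.card Γ : ℝ≥0∞) * ν (s ⁻¹' N) = 0 := by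
    have := congrArg (fun m => m (s ⁻¹' N)) h.map_proj
    simp only [Measure.smul_apply, smul_eq_mul] at this
    rw [← this, Measure.map_apply h.measurable_proj (h.measurable_section hN)]
    refine measure_mono_null (t := ⋃ a : Γ, (fun x => a • x) ⁻¹' N) ?_ ?_
    · intro x hx
      obtain ⟨a, ha⟩ := h.exists_smul (s (p x)) x (h.proj_section _)
      exact mem_iUnion.2 ⟨a, by simpa [← ha] using hx⟩
    · refine measure_iUnion_null fun a => ?_
      rw [(h.measurePreserving_smul a).measure_preimage hN.nullMeasurableSet, hμ]
  exact (mul_eq_zero.1 h1).resolve_left (card_ne_zero Γ)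

theorem ae_comp_iff (h : IsFiniteMeasureQuotient Γ p s μ ν) {P : Y → Prop} :
    (∀ᵐ x ∂μ, P (p x)) ↔ ∀ᵐ y ∂ν, P y := by
  refine ⟨fun hP => ?_, fun hP => h.quasiMeasurePreserving_proj.ae hP⟩
  filter_upwards [h.quasiMeasurePreserving_section.ae hP] with y hy
  rwa [h.proj_section] at hy

theorem aestronglyMeasurable_comp_iff (h : IsFiniteMeasureQuotient Γ p s μ ν) {f : Y → ℝ} :
    AEStronglyMeasurable (fun x => f (p x)) μ ↔ AEStronglyMeasurable f ν := by
  refine ⟨fun hf => ?_, fun hf => hf.comp_quasiMeasurePreserving h.quasiMeasurePreserving_proj⟩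
  have := hf.comp_quasiMeasurePreserving h.quasiMeasurePreserving_section
  simpa only [Function.comp_def, h.proj_section] using this

theorem integral_comp (h : IsFiniteMeasureQuotient Γ p s μ ν) (f : Y → ℝ) :
    ∫ x, f (p x) ∂μ = Nat.card Γ * ∫ y, f y ∂ν := by
  by_cases hf : AEStronglyMeasurable f ν
  · rw [← integral_map h.measurable_proj.aemeasurable, h.map_proj, integral_smul_measure]
    · simp
    · rw [h.map_proj]
      exact hf.mono_ac Measure.smul_absolutelyContinuous
  · rw [integral_non_aestronglyMeasurable hf,
      integral_non_aestronglyMeasurable (mt h.aestronglyMeasurable_comp_iff.1 hf), mul_zero]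

theorem lintegral_comp (h : IsFiniteMeasureQuotient Γ p s μ ν) {f : Y → ℝ≥0∞}
    (hf : Measurable f) : ∫⁻ x, f (p x) ∂μ = Nat.card Γ * ∫⁻ y, f y ∂ν := by
  rw [← lintegral_map hf h.measurable_proj, h.map_proj, lintegral_smul_measure, smul_eq_mul]

theorem eLpNorm_comp (h : IsFiniteMeasureQuotient Γ p s μ ν) {f : Y → ℝ}
    (hf : AEStronglyMeasurable f ν) :
    eLpNorm (fun x => f (p x)) 2 μ = (Nat.card Γ : ℝ≥0∞) ^ (1 / 2 : ℝ) * eLpNorm f 2 ν := by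
  have h1 : AEStronglyMeasurable f (Measure.map p μ) := by
    rw [h.map_proj]
    exact hf.mono_ac Measure.smul_absolutelyContinuous
  have h2 := eLpNorm_map_measure (p := 2) h1 h.measurable_proj.aemeasurable
  rw [h.map_proj, eLpNorm_smul_measure_of_ne_top (by simp)] at h2
  simpa [Function.comp_def] using h2.symm

theorem memLp_comp_iff (h : IsFiniteMeasureQuotient Γ p s μ ν) {f : Y → ℝ} :
    MemLp (fun x => f (p x)) 2 μ ↔ MemLp f 2 ν := by
  refine ⟨fun hf => ?_, fun hf => ?_⟩
  · have hm := h.aestronglyMeasurable_comp_iff.1 hf.1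
    refine ⟨hm, ?_⟩
    have := hf.2
    rw [h.eLpNorm_comp hm] at this
    refine lt_top_iff_ne_top.2 fun htop => this.ne ?_
    rw [htop, ENNReal.mul_top]
    simp [card_ne_zero Γ]
  · refine ⟨h.aestronglyMeasurable_comp_iff.2 hf.1, ?_⟩
    rw [h.eLpNorm_comp hf.1]
    exact ENNReal.mul_lt_top (ENNReal.rpow_lt_top_of_nonneg (by norm_num) (by simp)) hf.2

/-- The pull-back of square integrable functions by the quotient map. -/
noncomputable def pullback (h : IsFiniteMeasureQuotient Γ p s μ ν) : Lp ℝ 2 ν →ₗ[ℝ] Lp ℝ 2 μ where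
  toFun u := (h.memLp_comp_iff.2 (Lp.memLp u)).toLp
  map_add' u v := by
    rw [← MemLp.toLp_add, MemLp.toLp_eq_toLp_iff]
    exact h.quasiMeasurePreserving_proj.ae (Lp.coeFn_add u v)
  map_smul' c u := by
    rw [RingHom.id_apply, ← MemLp.toLp_const_smul, MemLp.toLp_eq_toLp_iff]
    exact h.quasiMeasurePreserving_proj.ae (Lp.coeFn_smul c u)

theorem coeFn_pullback (h : IsFiniteMeasureQuotient Γ p s μ ν) (u : Lp ℝ 2 ν) :
    h.pullback u =ᵐ[μ] fun x => u (p x) :=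
  (h.memLp_comp_iff.2 (Lp.memLp u)).coeFn_toLp

theorem pullback_injective (h : IsFiniteMeasureQuotient Γ p s μ ν) :
    Function.Injective h.pullback := by
  intro u v huv
  refine Lp.ext (h.ae_comp_iff.1 ?_)
  filter_upwards [h.coeFn_pullback u, h.coeFn_pullback v] with x h1 h2
  rw [← h1, ← h2, huv]

/-- An almost everywhere invariant function descends to the quotient. -/
theorem exists_pullback_eq (h : IsFiniteMeasureQuotient Γ p s μ ν) (u : Lp ℝ 2 μ)
    (hu : ∀ a : Γ, ∀ᵐ x ∂μ, u (a • x) = u x) : ∃ v, h.pullback v = u := by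
  have h1 : ∀ᵐ x ∂μ, u (s (p x)) = u x := by
    filter_upwards [ae_all_iff.2 hu] with x hx
    obtain ⟨a, ha⟩ := h.exists_smul (s (p x)) x (h.proj_section _)
    rw [ha, hx]
  have h2 : MemLp (fun y => u (s y)) 2 ν :=
    h.memLp_comp_iff.1 ((memLp_congr_ae h1).2 (Lp.memLp u))
  refine ⟨h2.toLp, Lp.ext ?_⟩
  filter_upwards [h.coeFn_pullback h2.toLp, h1, h.quasiMeasurePreserving_proj.ae h2.coeFn_toLp]
    with x hx1 hx2 hx3
  rw [hx1, hx3, hx2]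

theorem smul_pullback_ae (h : IsFiniteMeasureQuotient Γ p s μ ν) (v : Lp ℝ 2 ν) (a : Γ) :
    ∀ᵐ x ∂μ, h.pullback v (a • x) = h.pullback v x := by
  filter_upwards [h.coeFn_pullback v,
    (h.measurePreserving_smul a).quasiMeasurePreserving.ae (h.coeFn_pullback v)] with x h1 h2
  rw [h1, h2, h.proj_smul]

theorem tendsto_eLpNorm_comp (h : IsFiniteMeasureQuotient Γ p s μ ν)
    {F : ℕ → Y → ℝ} {v : Y → ℝ} (hF : ∀ k, AEStronglyMeasurable (F k) ν)
    (hv : AEStronglyMeasurable v ν)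
    (hlim : Tendsto (fun k => eLpNorm (fun y => F k y - v y) 2 ν) atTop (𝓝 0)) :
    Tendsto (fun k => eLpNorm (fun x => F k (p x) - v (p x)) 2 μ) atTop (𝓝 0) := by
  have h1 : ∀ k, eLpNorm (fun x => F k (p x) - v (p x)) 2 μ =
      (Nat.card Γ : ℝ≥0∞) ^ (1 / 2 : ℝ) * eLpNorm (fun y => F k y - v y) 2 ν :=
    fun k => h.eLpNorm_comp (f := fun y => F k y - v y) ((hF k).sub hv)
  simp only [h1]
  have := ENNReal.Tendsto.const_mul (a := (Nat.card Γ : ℝ≥0∞) ^ (1 / 2 : ℝ)) hlim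
    (Or.inr (ENNReal.rpow_ne_top_of_nonneg (by norm_num) (by simp)))
  simpa using this

section Average

variable [Fintype Γ]

theorem aestronglyMeasurable_smul (h : IsFiniteMeasureQuotient Γ p s μ ν) {f : X → ℝ}
    (hf : AEStronglyMeasurable f μ) (a : Γ) : AEStronglyMeasurable (fun x => f (a • x)) μ :=
  hf.comp_measurePreserving (h.measurePreserving_smul a)

/-- Averaging over the orbits is a contraction. -/
theorem eLpNorm_orbitAverage_le (h : IsFiniteMeasureQuotient Γ p s μ ν) {f : X → ℝ}
    (hf : AEStronglyMeasurable f μ) : eLpNorm (orbitAverage Γ f) 2 μ ≤ eLpNorm f 2 μ := by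
  have h1 : orbitAverage Γ f =
      (Fintype.card Γ : ℝ)⁻¹ • ∑ a : Γ, fun x => f (a • x) := by
    ext x
    simp [orbitAverage]
  have h2 : ∀ a : Γ, eLpNorm (fun x => f (a • x)) 2 μ = eLpNorm f 2 μ := fun a =>
    eLpNorm_comp_measurePreserving hf (h.measurePreserving_smul a)
  rw [h1, eLpNorm_const_smul]
  refine (mul_le_mul_right (eLpNorm_sum_le
    (fun a _ => h.aestronglyMeasurable_smul hf a) (by norm_num)) _).trans ?_
  simp only [h2, Finset.sum_const, Finset.card_univ, nsmul_eq_mul, ← mul_assoc]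
  refine le_of_eq ?_
  have h3 : (0 : ℝ) < Fintype.card Γ := by exact_mod_cast Fintype.card_pos
  rw [enorm_inv h3.ne', Real.enorm_of_nonneg h3.le, ENNReal.ofReal_natCast,
    ENNReal.inv_mul_cancel (by exact_mod_cast h3.ne') (by simp), one_mul]

theorem memLp_orbitAverage (h : IsFiniteMeasureQuotient Γ p s μ ν) {f : X → ℝ}
    (hf : MemLp f 2 μ) : MemLp (orbitAverage Γ f) 2 μ := by
  have h1 : orbitAverage Γ f = fun x => (Fintype.card Γ : ℝ)⁻¹ * ∑ a : Γ, f (a • x) := rfl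
  rw [h1]
  exact (memLp_finsetSum _ fun a _ =>
    hf.comp_measurePreserving (h.measurePreserving_smul a)).const_mul _

/-- The average of a square integrable function descends to the quotient. -/
theorem exists_comp_eq_orbitAverage (h : IsFiniteMeasureQuotient Γ p s μ ν) (u : Lp ℝ 2 μ) :
    ∃ v : Lp ℝ 2 ν, ∀ᵐ x ∂μ, v (p x) = orbitAverage Γ u x := by
  have hA := h.memLp_orbitAverage (Lp.memLp u)
  obtain ⟨v, hv⟩ := h.exists_pullback_eq hA.toLp fun a => by
    filter_upwards [hA.coeFn_toLp,
      (h.measurePreserving_smul a).quasiMeasurePreserving.ae hA.coeFn_toLp] with x h1 h2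
    rw [h1, h2, orbitAverage_smul_point]
  refine ⟨v, ?_⟩
  filter_upwards [h.coeFn_pullback v, hA.coeFn_toLp] with x h1 h2
  rw [← h1, hv, h2]

/-- If `f k` converges to `w` in quadratic mean, then the functions on the quotient that are given
by the averages of `f k` converge to the one given by the average of `w`. -/
theorem tendsto_eLpNorm_of_orbitAverage (h : IsFiniteMeasureQuotient Γ p s μ ν)
    {f : ℕ → X → ℝ} {F : ℕ → Y → ℝ} {w : X → ℝ} {v : Y → ℝ}
    (hf : ∀ k, AEStronglyMeasurable (f k) μ) (hw : AEStronglyMeasurable w μ)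
    (hF : ∀ k x, F k (p x) = orbitAverage Γ (f k) x)
    (hv : ∀ᵐ x ∂μ, v (p x) = orbitAverage Γ w x)
    (hlim : Tendsto (fun k => eLpNorm (fun x => f k x - w x) 2 μ) atTop (𝓝 0)) :
    Tendsto (fun k => eLpNorm (fun y => F k y - v y) 2 ν) atTop (𝓝 0) := by
  have h1 : ∀ k, (fun x => F k (p x) - v (p x)) =ᵐ[μ]
      orbitAverage Γ fun x => f k x - w x := by
    intro k
    filter_upwards [hv] with x hx
    rw [hx, hF, orbitAverage, orbitAverage, orbitAverage, Finset.sum_sub_distrib, mul_sub]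
  have hm : ∀ k, AEStronglyMeasurable (orbitAverage Γ fun x => f k x - w x) μ := by
    intro k
    have : orbitAverage Γ (fun x => f k x - w x) = fun x =>
        (Fintype.card Γ : ℝ)⁻¹ * ∑ a : Γ, (f k (a • x) - w (a • x)) := rfl
    rw [this]
    exact (Finset.aestronglyMeasurable_fun_sum _ fun a _ =>
      h.aestronglyMeasurable_smul ((hf k).sub hw) a).const_mul _
  have h2 : ∀ k, eLpNorm (fun y => F k y - v y) 2 ν ≤ eLpNorm (fun x => f k x - w x) 2 μ := by
    intro k
    have h3 : AEStronglyMeasurable (fun y => F k y - v y) ν :=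
      h.aestronglyMeasurable_comp_iff.1 ((aestronglyMeasurable_congr (h1 k)).2 (hm k))
    have h4 := h.eLpNorm_comp h3
    rw [eLpNorm_congr_ae (h1 k)] at h4
    refine le_trans ?_ (h.eLpNorm_orbitAverage_le ((hf k).sub hw))
    rw [h4]
    refine le_mul_of_one_le_left' ?_
    exact ENNReal.one_le_rpow (by exact_mod_cast Nat.card_pos) (by norm_num)
  exact tendsto_of_tendsto_of_tendsto_of_le_of_le tendsto_const_nhds hlim
    (fun _ => bot_le) h2

/-- Averaging is the adjoint of pulling back. -/
theorem integral_comp_mul (h : IsFiniteMeasureQuotient Γ p s μ ν) (v : Y → ℝ) {f : X → ℝ}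
    {F : Y → ℝ} (hF : ∀ᵐ x ∂μ, F (p x) = orbitAverage Γ f x)
    (hi : Integrable (fun x => v (p x) * f x) μ) :
    ∫ x, v (p x) * f x ∂μ = Nat.card Γ * ∫ y, v y * F y ∂ν := by
  have h0 : ∫ x, v (p x) * F (p x) ∂μ = ∫ x, v (p x) * orbitAverage Γ f x ∂μ :=
    integral_congr_ae (hF.mono fun x hx => by simp only [hx])
  rw [← h.integral_comp, h0]
  have h1 : ∀ a : Γ, ∫ x, v (p x) * f (a • x) ∂μ = ∫ x, v (p x) * f x ∂μ := by
    intro a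
    have hp := h.measurePreserving_smul a
    have h2 : Measure.map (fun x => a • x) μ = μ := hp.map_eq
    have h3 := integral_map (μ := μ) (φ := fun x : X => a • x) hp.measurable.aemeasurable
      (f := fun x => v (p x) * f x) (by rw [h2]; exact hi.1)
    rw [h2] at h3
    rw [h3]
    simp only [h.proj_smul]
  have h4 : ∀ a : Γ, Integrable (fun x => v (p x) * f (a • x)) μ := by
    intro a
    have := (h.measurePreserving_smul a).integrable_comp_of_integrable hi
    simpa only [Function.comp_def, h.proj_smul] using this
  have h5 : ∀ x, v (p x) * orbitAverage Γ f x =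
      (Fintype.card Γ : ℝ)⁻¹ * ∑ a : Γ, v (p x) * f (a • x) := by
    intro x
    rw [orbitAverage, ← Finset.mul_sum]
    ring
  simp only [h5]
  rw [integral_const_mul, integral_finsetSum _ fun a _ => h4 a]
  simp only [h1, Finset.sum_const, Finset.card_univ, nsmul_eq_mul]
  have : (Fintype.card Γ : ℝ) ≠ 0 := Nat.cast_ne_zero.2 Fintype.card_ne_zero
  field_simp

end Average

end IsFiniteMeasureQuotient

end FiniteQuotient

/-! ### Maps that do not increase the Riemannian distance -/

section RiemannianDistance

open scoped NNReal

attribute [local instance] normedAddCommGroupTangentSpaceVectorSpace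
attribute [local instance] normedSpaceTangentSpaceVectorSpace

variable {E : Type*} [NormedAddCommGroup E] [NormedSpace ℝ E] {H : Type*} [TopologicalSpace H]
  {I : ModelWithCorners ℝ E H}
  {M : Type*} [TopologicalSpace M] [ChartedSpace H M] [IsManifold I 1 M]
  [RiemannianBundle (fun x : M => TangentSpace I x)]
  {N : Type*} [TopologicalSpace N] [ChartedSpace H N] [IsManifold I 1 N]
  [RiemannianBundle (fun x : N => TangentSpace I x)]

/-- A map whose differential does not increase the norm on `U` does not increase the length of
paths in `U`. -/
theorem riemannianEDist_map_le_pathELength {φ : M → N} {U : Set M} (hU : IsOpen U)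
    (hφ : ContMDiffOn I I 1 φ U)
    (hn : ∀ x ∈ U, ∀ v : TangentSpace I x, ‖mfderiv I I φ x v‖ₑ ≤ ‖v‖ₑ) {γ : ℝ → M}
    (hγ : ContMDiffOn 𝓘(ℝ, ℝ) I 1 γ (Icc 0 1)) (hγU : ∀ t ∈ Icc (0 : ℝ) 1, γ t ∈ U) :
    riemannianEDist I (φ (γ 0)) (φ (γ 1)) ≤ pathELength I γ 0 1 := by
  refine (riemannianEDist_le_pathELength (γ := φ ∘ γ) (hφ.comp hγ hγU) rfl rfl
    zero_le_one).trans ?_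
  rw [pathELength_eq_lintegral_mfderivWithin_Icc, pathELength_eq_lintegral_mfderivWithin_Icc]
  refine setLIntegral_mono' measurableSet_Icc fun t ht => ?_
  have h1 : mfderivWithin 𝓘(ℝ, ℝ) I (φ ∘ γ) (Icc 0 1) t =
      (mfderiv I I φ (γ t)) ∘L (mfderivWithin 𝓘(ℝ, ℝ) I γ (Icc 0 1) t) := by
    refine mfderiv_comp_mfderivWithin t ?_ ?_ ?_
    · exact ((hφ _ (hγU t ht)).contMDiffAt (hU.mem_nhds (hγU t ht))).mdifferentiableAt (by simp)
    · exact hγ.mdifferentiableOn (by simp) t ht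
    · exact (uniqueMDiffWithinAt_iff_uniqueDiffWithinAt).2 (uniqueDiffOn_Icc zero_lt_one t ht)
  rw [h1]
  exact hn _ (hγU t ht) _

/-- A map whose differential does not increase the norm does not increase the distance. -/
theorem riemannianEDist_map_le {φ : M → N} (hφ : ContMDiff I I 1 φ)
    (hn : ∀ x, ∀ v : TangentSpace I x, ‖mfderiv I I φ x v‖ₑ ≤ ‖v‖ₑ) (x y : M) :
    riemannianEDist I (φ x) (φ y) ≤ riemannianEDist I x y := by
  refine le_of_forall_gt fun r hr => ?_
  obtain ⟨γ, rfl, rfl, hγ, hl⟩ := exists_lt_of_riemannianEDist_lt hr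
  exact (riemannianEDist_map_le_pathELength isOpen_univ hφ.contMDiffOn (fun x _ => hn x) hγ
    fun _ _ => mem_univ _).trans_lt hl

/-- A map defined near `x` whose differential does not increase the norm does not increase the
distance of points near `x`, since short paths between such points stay near `x`. -/
theorem exists_nhds_riemannianEDist_map_le [RegularSpace M]
    [IsContinuousRiemannianBundle E (fun x : M => TangentSpace I x)] {φ : M → N} {U : Set M}
    (hU : IsOpen U) (hφ : ContMDiffOn I I 1 φ U)
    (hn : ∀ x ∈ U, ∀ v : TangentSpace I x, ‖mfderiv I I φ x v‖ₑ ≤ ‖v‖ₑ) {x : M} (hx : x ∈ U) :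
    ∃ V ∈ 𝓝 x, V ⊆ U ∧
      ∀ y ∈ V, ∀ z ∈ V, riemannianEDist I (φ y) (φ z) ≤ riemannianEDist I y z := by
  obtain ⟨c, hc, hcU⟩ := setOfPred_riemannianEDist_lt_subset_nhds' I (hU.mem_nhds hx)
  have hc3 : 0 < c / 3 := ENNReal.div_pos hc.ne' (by simp)
  refine ⟨{y | riemannianEDist I x y < c / 3}, eventually_riemannianEDist_lt I x hc3, ?_, ?_⟩
  · refine fun y hy => hcU (show riemannianEDist I x y < c from lt_of_lt_of_le hy ?_)
    exact ENNReal.div_le_of_le_mul' (le_mul_of_one_le_left' (by norm_num))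
  intro y hy z hz
  refine le_of_forall_gt fun r hr => ?_
  have hyz : riemannianEDist I y z < c / 3 + c / 3 := by
    refine (riemannianEDist_triangle (y := x)).trans_lt (ENNReal.add_lt_add ?_ hz)
    rw [riemannianEDist_comm]
    exact hy
  obtain ⟨γ, rfl, rfl, hγ, hl⟩ := exists_lt_of_riemannianEDist_lt (lt_min hr hyz)
  refine (riemannianEDist_map_le_pathELength hU hφ hn hγ fun t ht => hcU ?_).trans_lt
    (hl.trans_le (min_le_left _ _))
  have h1 : riemannianEDist I (γ 0) (γ t) < c / 3 + c / 3 := by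
    refine lt_of_le_of_lt ?_ (hl.trans_le (min_le_right _ _))
    exact (riemannianEDist_le_pathELength (hγ.mono (Icc_subset_Icc_right ht.2)) rfl rfl
      ht.1).trans (pathELength_mono le_rfl ht.2)
  refine (riemannianEDist_triangle (y := γ 0)).trans_lt ((ENNReal.add_lt_add hy h1).trans_eq ?_)
  rw [← add_assoc]
  exact ENNReal.add_thirds c

/-- The inverse of an extended chart is Lipschitz near the image of the base point: the image of a
segment in the chart is a path of controlled length. -/
theorem exists_riemannianEDist_extChartAt_symm_le
    [IsContinuousRiemannianBundle E (fun x : M => TangentSpace I x)] (x : M) :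
    ∃ C : ℝ≥0, ∃ r > 0, Metric.ball (extChartAt I x x) r ∩ range I ⊆ (extChartAt I x).target ∧
      ∀ y ∈ Metric.ball (extChartAt I x x) r ∩ range I,
      ∀ z ∈ Metric.ball (extChartAt I x x) r ∩ range I,
        riemannianEDist I ((extChartAt I x).symm y) ((extChartAt I x).symm z) ≤ C * edist y z := by
  obtain ⟨C, -, hC'⟩ := eventually_enorm_mfderivWithin_symm_extChartAt_lt I x
  have hC : ∀ᶠ y in 𝓝[range I] (extChartAt I x x), ∀ v : E,
      ‖(mfderiv[range I] (extChartAt I x).symm y : E → _) v‖ₑ ≤ C * ‖v‖ₑ := by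
    refine hC'.mono fun y hy v => ?_
    have h := ContinuousLinearMap.le_opENorm (𝕜 := ℝ) (mfderiv[range I] (extChartAt I x).symm y) v
    exact h.trans (mul_le_mul_left hy.le _)
  obtain ⟨r, r_pos, hr⟩ : ∃ r > 0, Metric.ball (extChartAt I x x) r ∩ range I ⊆
      (extChartAt I x).target ∩
        {y | ∀ v : E, ‖(mfderiv[range I] (extChartAt I x).symm y : E → _) v‖ₑ ≤ C * ‖v‖ₑ} :=
    Metric.mem_nhdsWithin_iff.1 (inter_mem (extChartAt_target_mem_nhdsWithin x) hC)
  refine ⟨C, r, r_pos, hr.trans inter_subset_left, fun y hy z hz => ?_⟩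
  let η := ContinuousAffineMap.lineMap (R := ℝ) y z
  set γ := (extChartAt I x).symm ∘ η
  have hη : Icc 0 1 ⊆ ⇑η ⁻¹' ((extChartAt I x).target ∩
        {y | ∀ v : E, ‖(mfderiv[range I] (extChartAt I x).symm y : E → _) v‖ₑ ≤ C * ‖v‖ₑ}) := by
    simp only [← image_subset_iff, ContinuousAffineMap.coe_lineMap_eq,
     ← segment_eq_image_lineMap, η]
    exact (((convex_ball _ _).inter I.convex_range).segment_subset hy hz).trans hr
  simp only [preimage_inter, subset_inter_iff] at hη
  have η_smooth : CMDiff[Icc 0 1] 1 η := by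
    apply ContMDiff.contMDiffOn
    rw [contMDiff_iff_contDiff]
    exact ContinuousAffineMap.contDiff _
  have h1 : riemannianEDist I ((extChartAt I x).symm y) ((extChartAt I x).symm z) ≤
      pathELength I γ 0 1 := by
    apply riemannianEDist_le_pathELength _ _ _ zero_le_one
    · exact (contMDiffOn_extChartAt_symm x).comp η_smooth hη.1
    · simp [γ, η, ContinuousAffineMap.coe_lineMap_eq]
    · simp [γ, η, ContinuousAffineMap.coe_lineMap_eq]
  refine h1.trans ?_
  rw [← lintegral_fderiv_lineMap_eq_edist, pathELength_eq_lintegral_mfderivWithin_Icc,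
    ← lintegral_const_mul' _ _ ENNReal.coe_ne_top]
  refine setLIntegral_mono' measurableSet_Icc fun t ht => ?_
  have h2 : mfderiv[Icc 0 1] γ t =
      (mfderiv[range I] (extChartAt I x).symm (η t)) ∘L (mfderiv[Icc 0 1] η t) := by
    refine mfderivWithin_comp _ ?_ ?_ ?_ ?_
    · exact mdifferentiableWithinAt_extChartAt_symm (hη.1 ht)
    · exact η_smooth.mdifferentiableOn one_ne_zero t ht
    · exact hη.1.trans (preimage_mono (extChartAt_target_subset_range x))
    · rw [uniqueMDiffWithinAt_iff_uniqueDiffWithinAt]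
      exact uniqueDiffOn_Icc zero_lt_one t ht
  have h3 : mfderiv[Icc 0 1] γ t 1 =
      (mfderiv[range I] (extChartAt I x).symm (η t)) (mfderiv[Icc 0 1] η t 1) := congr($h2 1)
  rw [h3]
  refine (hη.2 ht _).trans ?_
  simp only [mfderivWithin_eq_fderivWithin]
  exact le_of_eq rfl

end RiemannianDistance

/-! ### Hausdorff measures of Riemannian metrics -/

section HausdorffMeasure

open scoped NNReal

theorem LipschitzOnWith.euclideanHausdorffMeasure_image_le {X Y : Type*} [EMetricSpace X]
    [MeasurableSpace X] [BorelSpace X] [EMetricSpace Y] [MeasurableSpace Y] [BorelSpace Y]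
    {K : ℝ≥0} {f : X → Y} {s : Set X} (hf : LipschitzOnWith K f s) (d : ℕ) :
    μHE[d] (f '' s) ≤ (K : ℝ≥0∞) ^ (d : ℝ) * μHE[d] s := by
  rw [Measure.euclideanHausdorffMeasure_def, Measure.euclideanHausdorffMeasure_def,
    Measure.smul_apply, Measure.smul_apply, ENNReal.smul_def, ENNReal.smul_def, smul_eq_mul,
    smul_eq_mul, mul_left_comm]
  gcongr
  exact hf.hausdorffMeasure_image_le d.cast_nonneg

variable {n : ℕ} [NeZero n] {M : Type*} [TopologicalSpace M] [T2Space M] [CompactSpace M]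
  [ChartedSpace (EuclideanHalfSpace n) M] [IsManifold (𝓡∂ n) ∞ M]
  {N : Type*} [TopologicalSpace N] [T2Space N] [CompactSpace N]
  [ChartedSpace (EuclideanHalfSpace n) N] [IsManifold (𝓡∂ n) ∞ N]

/-- The Riemannian structure on the tangent bundle given by the metric `g`. -/
@[reducible] noncomputable def RiemMetric.bundle (g : RiemMetric n M) :
    RiemannianBundle (fun x : M => TangentSpace (𝓡∂ n) x) := ⟨g.toRiemannianMetric⟩

theorem RiemMetric.isContinuousRiemannianBundle (g : RiemMetric n M) :
    letI := g.bundle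
    IsContinuousRiemannianBundle (EuclideanSpace ℝ (Fin n))
      (fun x : M => TangentSpace (𝓡∂ n) x) :=
  let := g.bundle
  ⟨g.inner, g.contMDiff.continuous, fun _ _ _ => rfl⟩

/-- The Riemannian distance of `g`. -/
@[reducible] noncomputable def RiemMetric.emetric (g : RiemMetric n M) : EMetricSpace M :=
  let := g.bundle
  have := g.isContinuousRiemannianBundle
  EMetricSpace.ofRiemannianMetric (𝓡∂ n) M

theorem RiemMetric.edist_def (g : RiemMetric n M) (x y : M) :
    g.emetric.edist x y = letI := g.bundle; riemannianEDist (𝓡∂ n) x y := rfl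

theorem RiemMetric.enorm_eq (g : RiemMetric n M) (x : M) (v : TangentSpace (𝓡∂ n) x) :
    letI := g.bundle
    ‖v‖ₑ = ENNReal.ofReal (√(g.inner x v v)) := by
  let := g.bundle
  rw [← ofReal_norm, norm_eq_sqrt_real_inner]
  rfl

/-- A map that does not increase the Riemannian distance on a set does not increase the Hausdorff
measures of the set. -/
theorem riemannianHausdorffMeasure_image_le (g : RiemMetric n M) (g' : RiemMetric n N) {φ : M → N}
    {A : Set M} (hφ : ∀ x ∈ A, ∀ y ∈ A, g'.emetric.edist (φ x) (φ y) ≤ g.emetric.edist x y)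
    (d : ℕ) : riemannianHausdorffMeasure g' d (φ '' A) ≤ riemannianHausdorffMeasure g d A := by
  let := g.emetric
  let := g'.emetric
  let : MeasurableSpace M := borel M
  have : BorelSpace M := ⟨rfl⟩
  let : MeasurableSpace N := borel N
  have : BorelSpace N := ⟨rfl⟩
  have h : LipschitzOnWith 1 φ A := fun x hx y hy => by
    rw [ENNReal.coe_one, one_mul]
    exact hφ x hx y hy
  have := h.euclideanHausdorffMeasure_image_le d
  rwa [ENNReal.coe_one, ENNReal.one_rpow, one_mul] at this

/-- The map `φ : (M, g) → (N, g')` is smooth and its differential is isometric everywhere. -/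
structure IsLocalIsometry (g : RiemMetric n M) (g' : RiemMetric n N) (φ : M → N) : Prop where
  contMDiff : ContMDiff (𝓡∂ n) (𝓡∂ n) ∞ φ
  inner_mfderiv : ∀ (x : M) (v w : TangentSpace (𝓡∂ n) x),
    g'.inner (φ x) (mfderiv (𝓡∂ n) (𝓡∂ n) φ x v) (mfderiv (𝓡∂ n) (𝓡∂ n) φ x w) = g.inner x v w

theorem IsLocalIsometry.edist_le {g : RiemMetric n M} {g' : RiemMetric n N} {φ : M → N}
    (hφ : IsLocalIsometry g g' φ) (x y : M) :
    g'.emetric.edist (φ x) (φ y) ≤ g.emetric.edist x y := by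
  rw [RiemMetric.edist_def, RiemMetric.edist_def]
  let := g.bundle
  let := g'.bundle
  refine riemannianEDist_map_le (hφ.contMDiff.of_le (by simp)) (fun x v => ?_) x y
  rw [g.enorm_eq, g'.enorm_eq, hφ.inner_mfderiv]

/-- A smooth map that is defined and isometric on an open set does not increase distances near each
point of the set. The distances are those of `M` and `N`, not of the open set. -/
theorem exists_nhds_edist_map_le (g : RiemMetric n M) (g' : RiemMetric n N) {φ : M → N}
    {U : Set M} (hU : IsOpen U) (hφ : ContMDiffOn (𝓡∂ n) (𝓡∂ n) ∞ φ U)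
    (hi : ∀ x ∈ U, ∀ v : TangentSpace (𝓡∂ n) x, g'.inner (φ x) (mfderiv (𝓡∂ n) (𝓡∂ n) φ x v)
      (mfderiv (𝓡∂ n) (𝓡∂ n) φ x v) = g.inner x v v) {x : M} (hx : x ∈ U) :
    ∃ V ∈ 𝓝 x, V ⊆ U ∧ ∀ y ∈ V, ∀ z ∈ V,
      g'.emetric.edist (φ y) (φ z) ≤ g.emetric.edist y z := by
  simp only [RiemMetric.edist_def]
  let := g.bundle
  let := g'.bundle
  have := g.isContinuousRiemannianBundle
  refine exists_nhds_riemannianEDist_map_le hU (hφ.of_le (by simp)) (fun x hx v => ?_) hx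
  rw [g.enorm_eq, g'.enorm_eq, hi x hx]

end HausdorffMeasure

/-! ### Finiteness of the volume and boundary measures -/

section Finiteness

open scoped NNReal

/-- The hyperplane that bounds the half space has locally finite Hausdorff measure. -/
theorem euclideanHausdorffMeasure_hyperplane_inter_ball_lt_top (n : ℕ) [NeZero n]
    (x : EuclideanSpace ℝ (Fin n)) (r : ℝ) :
    μHE[n - 1] (Metric.ball x r ∩ {y : EuclideanSpace ℝ (Fin n) | 0 = y 0}) < ⊤ := by
  let F : Submodule ℝ (EuclideanSpace ℝ (Fin n)) :=
    LinearMap.ker (EuclideanSpace.proj (0 : Fin n) : EuclideanSpace ℝ (Fin n) →L[ℝ] ℝ).toLinearMap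
  have hF : Module.finrank ℝ F = n - 1 := by
    have h1 := LinearMap.finrank_range_add_finrank_ker
      (EuclideanSpace.proj (0 : Fin n) : EuclideanSpace ℝ (Fin n) →L[ℝ] ℝ).toLinearMap
    have h2 : LinearMap.range
        (EuclideanSpace.proj (0 : Fin n) : EuclideanSpace ℝ (Fin n) →L[ℝ] ℝ).toLinearMap = ⊤ := by
      refine LinearMap.range_eq_top.2 fun c => ⟨EuclideanSpace.single 0 c, by simp⟩
    rw [h2, finrank_top, Module.finrank_self, finrank_euclideanSpace_fin] at h1
    change 1 + Module.finrank ℝ F = n at h1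
    omega
  rcases (Metric.ball x r ∩ {y : EuclideanSpace ℝ (Fin n) | 0 = y 0}).eq_empty_or_nonempty with
    h0 | ⟨z, hz, hz0⟩
  · rw [h0, measure_empty]
    exact ENNReal.zero_lt_top
  let z' : F := ⟨z, by simpa [F, eq_comm] using hz0⟩
  have h1 : Metric.ball x r ∩ {y : EuclideanSpace ℝ (Fin n) | 0 = y 0} ⊆
      Subtype.val '' (Metric.closedBall z' (r + r)) := by
    rintro y ⟨hy, hy0⟩
    refine ⟨⟨y, by simpa [F, eq_comm] using hy0⟩, ?_, rfl⟩
    rw [Metric.mem_closedBall, Subtype.dist_eq]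
    exact ((dist_triangle_right y z x).trans (add_le_add hy.le hz.le))
  refine (measure_mono h1).trans_lt ?_
  rw [Isometry.euclideanHausdorffMeasure_image isometry_subtype_coe, ← hF]
  exact (isCompact_closedBall z' (r + r)).measure_lt_top

variable {n : ℕ} [NeZero n] {M : Type*} [TopologicalSpace M] [T2Space M] [CompactSpace M]
  [ChartedSpace (EuclideanHalfSpace n) M] [IsManifold (𝓡∂ n) ∞ M]

theorem measurableSet_boundary : @MeasurableSet M (borel M) ((𝓡∂ n).boundary M) := by
  let : MeasurableSpace M := borel M
  have : BorelSpace M := ⟨rfl⟩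
  exact ((𝓡∂ n).isClosed_boundary (n := ∞) (by simp)).measurableSet

/-- The Hausdorff measure of a piece of the manifold is controlled by the one of its image in a
chart. -/
theorem exists_riemannianHausdorffMeasure_le (g : RiemMetric n M) (x : M) :
    ∃ C : ℝ≥0, ∃ r : ℝ, ∃ V ∈ 𝓝 x, V ⊆ (extChartAt (𝓡∂ n) x).source ∧
      extChartAt (𝓡∂ n) x '' V ⊆ Metric.ball (extChartAt (𝓡∂ n) x x) r ∧
      ∀ A ⊆ V, ∀ d : ℕ, riemannianHausdorffMeasure g d A ≤
        (C : ℝ≥0∞) ^ (d : ℝ) * μHE[d] (extChartAt (𝓡∂ n) x '' A) := by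
  obtain ⟨C, r, hr, -, hC⟩ : ∃ C : ℝ≥0, ∃ r > 0, _ ∧
      ∀ y ∈ Metric.ball (extChartAt (𝓡∂ n) x x) r ∩ range (𝓡∂ n),
      ∀ z ∈ Metric.ball (extChartAt (𝓡∂ n) x x) r ∩ range (𝓡∂ n),
        g.emetric.edist ((extChartAt (𝓡∂ n) x).symm y) ((extChartAt (𝓡∂ n) x).symm z) ≤
          C * edist y z := by
    simp only [RiemMetric.edist_def]
    let := g.bundle
    have := g.isContinuousRiemannianBundle
    exact exists_riemannianEDist_extChartAt_symm_le x
  let V := (extChartAt (𝓡∂ n) x).source ∩ extChartAt (𝓡∂ n) x ⁻¹'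
    (Metric.ball (extChartAt (𝓡∂ n) x x) r)
  refine ⟨C, r, V, ?_, inter_subset_left, ?_, ?_⟩
  · exact inter_mem (extChartAt_source_mem_nhds x)
      ((continuousAt_extChartAt x).preimage_mem_nhds (Metric.ball_mem_nhds _ hr))
  · rintro _ ⟨y, hy, rfl⟩
    exact hy.2
  intro A hA d
  let := g.emetric
  let : MeasurableSpace M := borel M
  have : BorelSpace M := ⟨rfl⟩
  have h1 : LipschitzOnWith C (extChartAt (𝓡∂ n) x).symm (extChartAt (𝓡∂ n) x '' A) := by
    rintro _ ⟨y, hy, rfl⟩ _ ⟨z, hz, rfl⟩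
    exact hC _ ⟨(hA hy).2, mem_range_self _⟩ _ ⟨(hA hz).2, mem_range_self _⟩
  have h2 := h1.euclideanHausdorffMeasure_image_le d
  have h3 : (extChartAt (𝓡∂ n) x).symm '' (extChartAt (𝓡∂ n) x '' A) = A :=
    (extChartAt (𝓡∂ n) x).symm_image_image_of_subset_source fun y hy => (hA hy).1
  rwa [h3] at h2

instance isFiniteMeasure_volumeMeasure (g : RiemMetric n M) :
    @IsFiniteMeasure M (borel M) (volumeMeasure g) := by
  let : MeasurableSpace M := borel M
  refine ⟨isCompact_univ.measure_lt_top_of_nhdsWithin fun x _ => ?_⟩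
  obtain ⟨C, r, V, hV, -, hVr, hC⟩ := exists_riemannianHausdorffMeasure_le g x
  refine ⟨V, mem_nhdsWithin_of_mem_nhds hV, (hC V subset_rfl n).trans_lt ?_⟩
  refine ENNReal.mul_lt_top (ENNReal.rpow_lt_top_of_nonneg n.cast_nonneg (by simp)) ?_
  refine (measure_mono hVr).trans_lt ?_
  rw [EuclideanSpace.euclideanHausdorffMeasure_eq_volume]
  exact measure_ball_lt_top

instance isFiniteMeasure_boundaryMeasure (g : RiemMetric n M) :
    @IsFiniteMeasure M (borel M) (boundaryMeasure g) := by
  let : MeasurableSpace M := borel M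
  refine ⟨?_⟩
  rw [boundaryMeasure, Measure.restrict_apply_univ]
  refine ((𝓡∂ n).isClosed_boundary (n := ∞) (by simp)).isCompact.measure_lt_top_of_nhdsWithin
    fun x _ => ?_
  obtain ⟨C, r, V, hV, hVs, hVr, hC⟩ := exists_riemannianHausdorffMeasure_le g x
  refine ⟨V ∩ (𝓡∂ n).boundary M, inter_mem (mem_nhdsWithin_of_mem_nhds hV) self_mem_nhdsWithin,
    (hC _ inter_subset_left (n - 1)).trans_lt ?_⟩
  refine ENNReal.mul_lt_top (ENNReal.rpow_lt_top_of_nonneg (Nat.cast_nonneg _) (by simp)) ?_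
  refine (measure_mono (t := Metric.ball (extChartAt (𝓡∂ n) x x) r ∩
    {y : EuclideanSpace ℝ (Fin n) | 0 = y 0}) ?_).trans_lt
    (euclideanHausdorffMeasure_hyperplane_inter_ball_lt_top n _ r)
  rintro _ ⟨y, ⟨hy, hyb⟩, rfl⟩
  refine ⟨hVr (mem_image_of_mem _ hy), ?_⟩
  have hys : y ∈ (chartAt (EuclideanHalfSpace n) x).source := by
    simpa only [extChartAt_source] using hVs hy
  rw [← frontier_range_modelWithCornersEuclideanHalfSpace]
  refine ⟨subset_closure (mem_range_self _), fun hint => ?_⟩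
  refine ((𝓡∂ n).isInteriorPoint_iff_not_isBoundaryPoint y).1 ?_ hyb
  rw [(𝓡∂ n).isInteriorPoint_iff_of_mem_atlas (n := ∞) (by simp) (chart_mem_atlas _ x) hys]
  exact (chartAt _ x).mem_interior_extend_target ((chartAt _ x).map_source hys) hint

end Finiteness

/-! ### The volume and boundary measures of the orbit manifold -/

section QuotientMeasure

variable {n : ℕ} [NeZero n] {M : Type*} [TopologicalSpace M] [T2Space M] [CompactSpace M]
  [ChartedSpace (EuclideanHalfSpace n) M] [IsManifold (𝓡∂ n) ∞ M]
  {N : Type*} [TopologicalSpace N] [T2Space N] [CompactSpace N]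
  [ChartedSpace (EuclideanHalfSpace n) N] [IsManifold (𝓡∂ n) ∞ N]

theorem surjective_mfderiv_of_injective {φ : M → N} {x : M}
    (hφ : ∀ v, mfderiv (𝓡∂ n) (𝓡∂ n) φ x v = 0 → v = 0) :
    Function.Surjective (mfderiv (𝓡∂ n) (𝓡∂ n) φ x) := by
  have : FiniteDimensional ℝ (TangentSpace (𝓡∂ n) x) :=
    inferInstanceAs (FiniteDimensional ℝ (EuclideanSpace ℝ (Fin n)))
  let L : EuclideanSpace ℝ (Fin n) →ₗ[ℝ] EuclideanSpace ℝ (Fin n) :=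
    (mfderiv (𝓡∂ n) (𝓡∂ n) φ x).toLinearMap
  have hL : Function.Injective L := (injective_iff_map_eq_zero L).2 hφ
  exact LinearMap.injective_iff_surjective (f := L) |>.1 hL

theorem IsLocalIsometry.surjective_mfderiv {g : RiemMetric n M} {g' : RiemMetric n N} {φ : M → N}
    (hφ : IsLocalIsometry g g' φ) (x : M) :
    Function.Surjective (mfderiv (𝓡∂ n) (𝓡∂ n) φ x) := by
  refine surjective_mfderiv_of_injective fun v hv => ?_
  by_contra h0
  have h1 := g.pos x v h0
  rw [← hφ.inner_mfderiv, hv, map_zero] at h1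
  exact lt_irrefl _ h1

/-- A local isometry between manifolds of the same dimension maps the interior to the interior, by
the inverse function theorem. -/
theorem IsLocalIsometry.mem_interior {g : RiemMetric n M} {g' : RiemMetric n N} {φ : M → N}
    (hφ : IsLocalIsometry g g' φ) {x : M} (hx : x ∈ (𝓡∂ n).interior M) :
    φ x ∈ (𝓡∂ n).interior N :=
  ((hφ.contMDiff x).mdifferentiableAt (by simp)).isInteriorPoint_of_surjective_mfderiv
    (hφ.surjective_mfderiv x) hx

variable {Γ : Type*} [Group Γ] [MulAction Γ M] [ContinuousConstSMul Γ M]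
  [SmoothConstSMul (𝓡∂ n) Γ M] {g : RiemMetric n M}

theorem ActsByIsometries.isLocalIsometry (hg : ActsByIsometries g Γ) (a : Γ) :
    IsLocalIsometry g g (fun x : M => a • x) :=
  ⟨SmoothConstSMul.contMDiff_const_smul a, hg a⟩

theorem ActsByIsometries.smul_mem_interior_iff (hg : ActsByIsometries g Γ) (a : Γ) (x : M) :
    a • x ∈ (𝓡∂ n).interior M ↔ x ∈ (𝓡∂ n).interior M := by
  refine ⟨fun h => ?_, fun h => (hg.isLocalIsometry a).mem_interior h⟩
  simpa using (hg.isLocalIsometry a⁻¹).mem_interior h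

theorem ActsByIsometries.preimage_boundary (hg : ActsByIsometries g Γ) (a : Γ) :
    (fun x : M => a • x) ⁻¹' (𝓡∂ n).boundary M = (𝓡∂ n).boundary M := by
  rw [← (𝓡∂ n).compl_interior]
  ext x
  simp [hg.smul_mem_interior_iff]

theorem ActsByIsometries.measurePreserving_hausdorff (hg : ActsByIsometries g Γ) (a : Γ) (d : ℕ) :
    @MeasurePreserving M M (borel M) (borel M) (fun x : M => a • x) (riemannianHausdorffMeasure g d)
      (riemannianHausdorffMeasure g d) := by
  let : MeasurableSpace M := borel M
  have : BorelSpace M := ⟨rfl⟩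
  have key : ∀ (b : Γ) (A : Set M), riemannianHausdorffMeasure g d ((fun x => b • x) '' A) ≤
      riemannianHausdorffMeasure g d A := fun b A =>
    riemannianHausdorffMeasure_image_le g g
      (fun x _ y _ => (hg.isLocalIsometry b).edist_le x y) d
  refine ⟨(continuous_const_smul a).measurable, Measure.ext fun A hA => ?_⟩
  rw [Measure.map_apply (continuous_const_smul a).measurable hA]
  refine le_antisymm ?_ ?_
  · have h1 := key a⁻¹ A
    rwa [Set.image_smul, ← Set.preimage_smul_inv, inv_inv] at h1
  · have h1 := key a ((fun x => a • x) ⁻¹' A)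
    rwa [Set.image_preimage_eq _ (MulAction.surjective a)] at h1

theorem ActsByIsometries.measurePreserving_volume (hg : ActsByIsometries g Γ) (a : Γ) :
    @MeasurePreserving M M (borel M) (borel M) (fun x : M => a • x) (volumeMeasure g)
      (volumeMeasure g) :=
  hg.measurePreserving_hausdorff a n

theorem ActsByIsometries.measurePreserving_boundary (hg : ActsByIsometries g Γ) (a : Γ) :
    @MeasurePreserving M M (borel M) (borel M) (fun x : M => a • x) (boundaryMeasure g)
      (boundaryMeasure g) := by
  let : MeasurableSpace M := borel M
  have h := (hg.measurePreserving_hausdorff a (n - 1)).restrict_preimage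
    (s := (𝓡∂ n).boundary M) measurableSet_boundary
  rwa [hg.preimage_boundary] at h

variable [Finite Γ] [IsCancelSMul Γ M]

theorem isLocalIsometry_orbitMap (hg : ActsByIsometries g Γ) :
    IsLocalIsometry g (quotientMetric g Γ hg) (orbitMap Γ M) :=
  ⟨orbitMap_contMDiff, quotientMetric_pullback g hg⟩

theorem localSection_orbitMap_self (x : M) : localSection Γ x (orbitMap Γ M x) = x :=
  (orbitMap_isLocalHomeomorph (Γ := Γ) (M := M)).localInverseAt_apply_self

theorem orbitMap_mem_interior_iff (hg : ActsByIsometries g Γ) (x : M) :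
    orbitMap Γ M x ∈ (𝓡∂ n).interior (MulAction.orbitRel.Quotient Γ M) ↔
      x ∈ (𝓡∂ n).interior M := by
  refine ⟨fun h => ?_, fun h => (isLocalIsometry_orbitMap hg).mem_interior h⟩
  have hs := mem_localSection_source (Γ := Γ) x
  have h1 : localSection Γ x (orbitMap Γ M x) ∈ (𝓡∂ n).interior M := by
    refine ((localSection_contMDiffAt (I := 𝓡∂ n) hs).mdifferentiableAt
      (by simp)).isInteriorPoint_of_surjective_mfderiv ?_ h
    refine surjective_mfderiv_of_injective fun v hv => ?_
    rw [← mfderiv_orbitMap_comp (I := 𝓡∂ n) hs v, hv, map_zero]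
    rfl
  rwa [localSection_orbitMap_self] at h1

theorem preimage_orbitMap_boundary (hg : ActsByIsometries g Γ) :
    orbitMap Γ M ⁻¹' (𝓡∂ n).boundary (MulAction.orbitRel.Quotient Γ M) = (𝓡∂ n).boundary M := by
  rw [← (𝓡∂ n).compl_interior, ← (𝓡∂ n).compl_interior, preimage_compl]
  congr 1
  ext x
  exact orbitMap_mem_interior_iff hg x

/-- Around each point of the orbit space there is an open set on which a local section of the orbit
map does not increase the distance. -/
theorem exists_isOpen_edist_localSection_le (hg : ActsByIsometries g Γ)
    (q : MulAction.orbitRel.Quotient Γ M) :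
    ∃ U : Set (MulAction.orbitRel.Quotient Γ M), IsOpen U ∧ q ∈ U ∧
      U ⊆ (localSection Γ (Quotient.out q)).source ∧ ∀ y ∈ U, ∀ z ∈ U,
        g.emetric.edist (localSection Γ (Quotient.out q) y) (localSection Γ (Quotient.out q) z) ≤
          (RiemMetric.emetric (quotientMetric g Γ hg)).edist y z := by
  have hi : ∀ y ∈ (localSection Γ (Quotient.out q)).source, ∀ v : TangentSpace (𝓡∂ n) y,
      g.inner (localSection Γ (Quotient.out q) y)
        (mfderiv (𝓡∂ n) (𝓡∂ n) (localSection Γ (Quotient.out q)) y v)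
        (mfderiv (𝓡∂ n) (𝓡∂ n) (localSection Γ (Quotient.out q)) y v) =
          (quotientMetric g Γ hg).inner y v v := by
    intro y hy v
    change _ = pulledInner g Γ (Quotient.out y) y v v
    rw [pulledInner_eq g hg (mem_localSection_out y) hy, pulledInner_apply]
  obtain ⟨V, hV, hVs, hle⟩ := exists_nhds_edist_map_le (quotientMetric g Γ hg) g
    (φ := localSection Γ (Quotient.out q)) (localSection Γ (Quotient.out q)).open_source
    (fun y hy => (localSection_contMDiffAt (I := 𝓡∂ n) hy).contMDiffWithinAt)
    hi (mem_localSection_out q)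
  exact ⟨interior V, isOpen_interior, mem_interior_iff_mem_nhds.2 hV,
    interior_subset.trans hVs, fun y hy z hz =>
      hle y (interior_subset hy) z (interior_subset hz)⟩

/-- Over an open set with a distance non-increasing section, the preimage of the orbit map consists
of `|Γ|` disjoint isometric copies. -/
theorem riemannianHausdorffMeasure_preimage_orbitMap (hg : ActsByIsometries g Γ) (d : ℕ)
    {q : MulAction.orbitRel.Quotient Γ M} {U : Set (MulAction.orbitRel.Quotient Γ M)}
    (hU : IsOpen U) (hUs : U ⊆ (localSection Γ (Quotient.out q)).source)
    (hle : ∀ y ∈ U, ∀ z ∈ U,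
      g.emetric.edist (localSection Γ (Quotient.out q) y) (localSection Γ (Quotient.out q) z) ≤
        (RiemMetric.emetric (quotientMetric g Γ hg)).edist y z)
    {B : Set (MulAction.orbitRel.Quotient Γ M)} (hB : @MeasurableSet _ (borel _) B)
    (hBU : B ⊆ U) :
    riemannianHausdorffMeasure g d (orbitMap Γ M ⁻¹' B) =
      Nat.card Γ * riemannianHausdorffMeasure (quotientMetric g Γ hg) d B := by
  let : MeasurableSpace M := borel M
  have : BorelSpace M := ⟨rfl⟩
  let : MeasurableSpace (MulAction.orbitRel.Quotient Γ M) := borel _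
  have : BorelSpace (MulAction.orbitRel.Quotient Γ M) := ⟨rfl⟩
  set σ := localSection Γ (Quotient.out q) with hσ
  have hps : ∀ y ∈ B, orbitMap Γ M (σ y) = y := fun y hy =>
    orbitMap_localSection (hUs (hBU hy))
  -- the section and the orbit map are inverse to each other and neither increases distances
  have h1 : riemannianHausdorffMeasure g d (σ '' B) =
      riemannianHausdorffMeasure (quotientMetric g Γ hg) d B := by
    refine le_antisymm (riemannianHausdorffMeasure_image_le _ _
      (fun y hy z hz => hle y (hBU hy) z (hBU hz)) d) ?_
    have h2 := riemannianHausdorffMeasure_image_le g (quotientMetric g Γ hg) (A := σ '' B)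
      (fun x _ y _ => (isLocalIsometry_orbitMap hg).edist_le x y) d
    have h3 : orbitMap Γ M '' (σ '' B) = B := by
      rw [image_image]
      exact (image_congr hps).trans (image_id' B)
    rwa [h3] at h2
  have hmeas : MeasurableSet (σ '' B) := by
    have h2 : σ '' B = σ '' U ∩ orbitMap Γ M ⁻¹' B := by
      ext x
      constructor
      · rintro ⟨y, hy, rfl⟩
        exact ⟨mem_image_of_mem _ (hBU hy), by rw [mem_preimage, hps y hy]; exact hy⟩
      · rintro ⟨⟨y, hy, rfl⟩, hy2⟩
        rw [mem_preimage, orbitMap_localSection (hUs hy)] at hy2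
        exact mem_image_of_mem _ hy2
    rw [h2]
    exact (σ.isOpen_image_of_subset_source hU hUs).measurableSet.inter
      (orbitMap_isLocalHomeomorph.continuous.measurable hB)
  have h4 : orbitMap Γ M ⁻¹' B = ⋃ a : Γ, (fun x => a • x) ⁻¹' (σ '' B) := by
    ext x
    simp only [mem_preimage, mem_iUnion, mem_image]
    constructor
    · intro hx
      obtain ⟨a, ha⟩ := orbitMap_eq_iff.1 (hps _ hx)
      exact ⟨a, _, hx, ha⟩
    · rintro ⟨a, y, hy, hyx⟩
      rw [← orbitMap_smul a x, ← hyx, hps y hy]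
      exact hy
  have hdisj : Pairwise (Function.onFun Disjoint
      fun a : Γ => (fun x : M => a • x) ⁻¹' (σ '' B)) := by
    intro a b hab
    refine Set.disjoint_left.2 ?_
    rintro x ⟨y, hy, hyx⟩ ⟨z, hz, hzx⟩
    have hyz : y = z := by
      have h5 := congrArg (orbitMap Γ M) hyx
      have h6 := congrArg (orbitMap Γ M) hzx
      simp only [orbitMap_smul] at h5 h6
      rw [hps y hy] at h5
      rw [hps z hz] at h6
      rw [h5, h6]
    rw [← hyz] at hzx
    exact hab (IsCancelSMul.right_cancel _ _ _ (hyx.symm.trans hzx))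
  have := Fintype.ofFinite Γ
  rw [h4, measure_iUnion hdisj fun a => (continuous_const_smul a).measurable hmeas,
    tsum_fintype]
  simp only [(hg.measurePreserving_hausdorff _ d).measure_preimage hmeas.nullMeasurableSet, h1,
    Finset.sum_const, Finset.card_univ, nsmul_eq_mul, Nat.card_eq_fintype_card]

/-- The orbit manifold is covered by countably many open sets with distance non-increasing sections
of the orbit map. -/
theorem exists_cover_edist_localSection_le [Nonempty M] (hg : ActsByIsometries g Γ) :
    ∃ (q : ℕ → MulAction.orbitRel.Quotient Γ M)
      (U : ℕ → Set (MulAction.orbitRel.Quotient Γ M)), (⋃ k, U k = univ) ∧ ∀ k, IsOpen (U k) ∧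
      U k ⊆ (localSection Γ (Quotient.out (q k))).source ∧ ∀ y ∈ U k, ∀ z ∈ U k,
        g.emetric.edist (localSection Γ (Quotient.out (q k)) y)
          (localSection Γ (Quotient.out (q k)) z) ≤
            (RiemMetric.emetric (quotientMetric g Γ hg)).edist y z := by
  choose U hU hqU hUs hle using exists_isOpen_edist_localSection_le hg
  obtain ⟨t, ht⟩ := isCompact_univ.elim_finite_subcover U hU
    fun q _ => mem_iUnion.2 ⟨q, hqU q⟩
  have hne : t.Nonempty := by
    obtain ⟨x⟩ := ‹Nonempty M›
    obtain ⟨q, hq, -⟩ := mem_iUnion₂.1 (ht (mem_univ (orbitMap Γ M x)))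
    exact ⟨q, hq⟩
  obtain ⟨q, hq⟩ := (t.countable_toSet).exists_eq_range hne
  refine ⟨q, fun k => U (q k), eq_univ_of_univ_subset fun y hy => ?_,
    fun k => ⟨hU _, hUs _, hle _⟩⟩
  obtain ⟨z, hz, hyz⟩ := mem_iUnion₂.1 (ht hy)
  have hz' : z ∈ range q := by rw [← hq]; exact hz
  obtain ⟨k, rfl⟩ := hz'
  exact mem_iUnion.2 ⟨k, hyz⟩

/-- The orbit map has a Borel section, glued from countably many local sections. -/
theorem exists_measurable_section (hg : ActsByIsometries g Γ) :
    ∃ s : MulAction.orbitRel.Quotient Γ M → M, @Measurable _ _ (borel _) (borel M) s ∧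
      ∀ q, orbitMap Γ M (s q) = q := by
  classical
  let : MeasurableSpace M := borel M
  have : BorelSpace M := ⟨rfl⟩
  let : MeasurableSpace (MulAction.orbitRel.Quotient Γ M) := borel _
  have : BorelSpace (MulAction.orbitRel.Quotient Γ M) := ⟨rfl⟩
  rcases isEmpty_or_nonempty M with hM | hM
  · have : IsEmpty (MulAction.orbitRel.Quotient Γ M) :=
      ⟨fun q => hM.elim (Quotient.out q)⟩
    exact ⟨fun q => isEmptyElim q, measurable_of_empty _, fun q => isEmptyElim q⟩
  obtain ⟨q, U, hcov, hU⟩ := exists_cover_edist_localSection_le hg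
  have hex : ∀ y, ∃ k, y ∈ U k := fun y => mem_iUnion.1 (hcov ▸ mem_univ y)
  have hN : Measurable fun y => Nat.find (hex y) :=
    measurable_find hex fun k => (hU k).1.measurableSet
  -- at each point, the first available local section is used
  refine ⟨fun y => localSection Γ (Quotient.out (q (Nat.find (hex y)))) y, ?_, fun y =>
    orbitMap_localSection ((hU _).2.1 (Nat.find_spec (hex y)))⟩
  refine measurable_of_isOpen fun O hO => ?_
  have : (fun y => localSection Γ (Quotient.out (q (Nat.find (hex y)))) y) ⁻¹' O =
      ⋃ k, (fun y => Nat.find (hex y)) ⁻¹' {k} ∩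
        ((localSection Γ (Quotient.out (q k))).source ∩
          localSection Γ (Quotient.out (q k)) ⁻¹' O) := by
    ext y
    simp only [mem_preimage, mem_iUnion, mem_inter_iff, mem_singleton_iff]
    constructor
    · intro hy
      exact ⟨_, rfl, (hU _).2.1 (Nat.find_spec (hex y)), hy⟩
    · rintro ⟨k, hk, -, hy⟩
      rw [hk]
      exact hy
  rw [this]
  exact MeasurableSet.iUnion fun k => (hN (measurableSet_singleton k)).inter
    ((localSection Γ (Quotient.out (q k))).isOpen_inter_preimage hO).measurableSet

/-- The orbit map multiplies the Hausdorff measures by the number of sheets. -/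
theorem map_orbitMap_riemannianHausdorffMeasure (hg : ActsByIsometries g Γ) (d : ℕ) :
    @Measure.map _ _ (borel M) (borel _) (orbitMap Γ M) (riemannianHausdorffMeasure g d) =
      (Nat.card Γ : ℝ≥0∞) • riemannianHausdorffMeasure (quotientMetric g Γ hg) d := by
  let : MeasurableSpace M := borel M
  have : BorelSpace M := ⟨rfl⟩
  let : MeasurableSpace (MulAction.orbitRel.Quotient Γ M) := borel _
  have : BorelSpace (MulAction.orbitRel.Quotient Γ M) := ⟨rfl⟩
  have hp : Measurable (orbitMap Γ M) := orbitMap_isLocalHomeomorph.continuous.measurable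
  rcases isEmpty_or_nonempty M with hM | hM
  · have : IsEmpty (MulAction.orbitRel.Quotient Γ M) :=
      ⟨fun q => hM.elim (Quotient.out q)⟩
    exact Subsingleton.elim _ _
  obtain ⟨q, U, hcov, hU⟩ := exists_cover_edist_localSection_le hg
  refine (Measure.ext_iff_of_iUnion_eq_univ hcov).2 fun k => Measure.ext fun A hA => ?_
  have hAU : MeasurableSet (A ∩ U k) := hA.inter (hU k).1.measurableSet
  rw [Measure.restrict_apply hA, Measure.restrict_apply hA, Measure.map_apply hp hAU,
    Measure.smul_apply, smul_eq_mul]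
  exact riemannianHausdorffMeasure_preimage_orbitMap hg d (hU k).1 (hU k).2.1 (hU k).2.2 hAU
    inter_subset_right

/-- The orbit manifold is the quotient of `M` as a measure space, for the volume measure and for the
boundary measure. -/
theorem exists_isFiniteMeasureQuotient (hg : ActsByIsometries g Γ) :
    ∃ s : MulAction.orbitRel.Quotient Γ M → M,
      IsFiniteMeasureQuotient Γ (orbitMap Γ M) s (volumeMeasure g)
        (volumeMeasure (quotientMetric g Γ hg)) ∧
      IsFiniteMeasureQuotient Γ (orbitMap Γ M) s (boundaryMeasure g)
        (boundaryMeasure (quotientMetric g Γ hg)) := by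
  obtain ⟨s, hs, hps⟩ := exists_measurable_section (Γ := Γ) hg
  let : MeasurableSpace M := borel M
  have : BorelSpace M := ⟨rfl⟩
  let : MeasurableSpace (MulAction.orbitRel.Quotient Γ M) := borel _
  have : BorelSpace (MulAction.orbitRel.Quotient Γ M) := ⟨rfl⟩
  have hp : Measurable (orbitMap Γ M) := orbitMap_isLocalHomeomorph.continuous.measurable
  refine ⟨s, ⟨hp, hs, hps, orbitMap_smul, fun x x' => orbitMap_eq_iff.1,
    hg.measurePreserving_volume, map_orbitMap_riemannianHausdorffMeasure hg n⟩,
    ⟨hp, hs, hps, orbitMap_smul, fun x x' => orbitMap_eq_iff.1,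
    hg.measurePreserving_boundary, ?_⟩⟩
  rw [boundaryMeasure, boundaryMeasure, ← preimage_orbitMap_boundary hg,
    ← Measure.restrict_map hp measurableSet_boundary,
    map_orbitMap_riemannianHausdorffMeasure hg, Measure.restrict_smul]

end QuotientMeasure

/-! ### Inner products of gradients -/

section Gradient

variable {n : ℕ} [NeZero n] {M : Type*} [TopologicalSpace M] [T2Space M] [CompactSpace M]
  [ChartedSpace (EuclideanHalfSpace n) M] [IsManifold (𝓡∂ n) ∞ M]
  {N : Type*} [TopologicalSpace N] [T2Space N] [CompactSpace N]
  [ChartedSpace (EuclideanHalfSpace n) N] [IsManifold (𝓡∂ n) ∞ N]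

/-- The gradient is determined by its inner products, since the metric is nondegenerate. -/
theorem riemannianGradient_eq_of_forall (g : RiemMetric n M) {f : M → ℝ} {x : M}
    {w : TangentSpace (𝓡∂ n) x}
    (hw : ∀ v, g.inner x w v = mfderiv (𝓡∂ n) 𝓘(ℝ, ℝ) f x v) : riemannianGradient g f x = w := by
  rw [← sub_eq_zero]
  by_contra h0
  have h1 : ∀ v, g.inner x (riemannianGradient g f x - w) v = 0 := fun v => by
    rw [map_sub]
    exact sub_eq_zero.2 ((inner_riemannianGradient g f x v).trans (hw v).symm)
  exact (g.pos x _ h0).ne' (h1 _)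

theorem gradInner_eq_mfderiv (g : RiemMetric n M) (f φ : M → ℝ) (x : M) :
    gradInner g f φ x = mfderiv (𝓡∂ n) 𝓘(ℝ, ℝ) f x (riemannianGradient g φ x) :=
  inner_riemannianGradient g f x _

theorem gradInner_comm (g : RiemMetric n M) (f φ : M → ℝ) (x : M) :
    gradInner g f φ x = gradInner g φ f x :=
  g.symm x _ _

theorem gradInner_self_nonneg (g : RiemMetric n M) (f : M → ℝ) (x : M) :
    0 ≤ gradInner g f f x := by
  by_cases h : riemannianGradient g f x = 0
  · rw [gradInner, h, map_zero]
  · exact (g.pos x _ h).le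

theorem SmoothFunction.mdifferentiableAt (f : SmoothFunction n M) (x : M) :
    MDifferentiableAt (𝓡∂ n) 𝓘(ℝ, ℝ) f x :=
  (f.contMDiff x).mdifferentiableAt (by simp)

theorem gradInner_add_left (g : RiemMetric n M) (f h : SmoothFunction n M) (φ : M → ℝ) (x : M) :
    gradInner g (f + h : SmoothFunction n M) φ x = gradInner g f φ x + gradInner g h φ x := by
  rw [gradInner_eq_mfderiv, gradInner_eq_mfderiv, gradInner_eq_mfderiv, ContMDiffMap.coe_add,
    mfderiv_add (SmoothFunction.mdifferentiableAt f x) (SmoothFunction.mdifferentiableAt h x)]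
  rfl

theorem gradInner_smul_left (g : RiemMetric n M) (c : ℝ) (f : SmoothFunction n M) (φ : M → ℝ)
    (x : M) : gradInner g (c • f : SmoothFunction n M) φ x = c * gradInner g f φ x := by
  rw [gradInner_eq_mfderiv, gradInner_eq_mfderiv, ContMDiffMap.coe_smul,
    const_smul_mfderiv (SmoothFunction.mdifferentiableAt f x)]
  rfl

theorem gradInner_add_right (g : RiemMetric n M) (φ : M → ℝ) (f h : SmoothFunction n M) (x : M) :
    gradInner g φ (f + h : SmoothFunction n M) x = gradInner g φ f x + gradInner g φ h x := by
  rw [gradInner_comm, gradInner_add_left, gradInner_comm, gradInner_comm g h]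

theorem gradInner_smul_right (g : RiemMetric n M) (c : ℝ) (φ : M → ℝ) (f : SmoothFunction n M)
    (x : M) : gradInner g φ (c • f : SmoothFunction n M) x = c * gradInner g φ f x := by
  rw [gradInner_comm, gradInner_smul_left, gradInner_comm]

theorem gradInner_sum_left (g : RiemMetric n M) {ι : Type*} (t : Finset ι)
    (f : ι → SmoothFunction n M) (φ : M → ℝ) (x : M) :
    gradInner g (∑ i ∈ t, f i : SmoothFunction n M) φ x = ∑ i ∈ t, gradInner g (f i) φ x := by
  classical
  induction t using Finset.induction_on with
  | empty =>
    have := gradInner_smul_left g 0 0 φ x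
    simpa using this
  | insert i t hi ih => rw [Finset.sum_insert hi, Finset.sum_insert hi, gradInner_add_left, ih]

/-- The inequality `|a + b|² ≤ 2 |a|² + 2 |b|²`. -/
theorem gradInner_add_self_le (g : RiemMetric n M) (f h : SmoothFunction n M) (x : M) :
    gradInner g (f + h : SmoothFunction n M) (f + h : SmoothFunction n M) x ≤
      2 * gradInner g f f x + 2 * gradInner g h h x := by
  have h1 := gradInner_self_nonneg g (f + (-1 : ℝ) • h : SmoothFunction n M) x
  rw [gradInner_add_left, gradInner_add_right, gradInner_add_right, gradInner_smul_left,
    gradInner_smul_left, gradInner_smul_right, gradInner_smul_right] at h1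
  rw [gradInner_add_left, gradInner_add_right, gradInner_add_right]
  linarith

/-- Local isometries preserve the inner products of gradients. -/
theorem IsLocalIsometry.gradInner_comp {g : RiemMetric n M} {g' : RiemMetric n N} {ψ : M → N}
    (hψ : IsLocalIsometry g g' ψ) (f φ : SmoothFunction n N) (x : M) :
    gradInner g (f ∘ ψ) (φ ∘ ψ) x = gradInner g' f φ (ψ x) := by
  have key : ∀ f : SmoothFunction n N, mfderiv (𝓡∂ n) (𝓡∂ n) ψ x (riemannianGradient g (f ∘ ψ) x) =
      riemannianGradient g' f (ψ x) := by
    intro f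
    obtain ⟨w, hw⟩ := hψ.surjective_mfderiv x (riemannianGradient g' f (ψ x))
    rw [← hw]
    congr 1
    refine riemannianGradient_eq_of_forall g fun v => ?_
    rw [← hψ.inner_mfderiv, hw, inner_riemannianGradient,
      mfderiv_comp x (SmoothFunction.mdifferentiableAt f (ψ x))
        ((hψ.contMDiff x).mdifferentiableAt (by simp))]
    rfl
  rw [gradInner, gradInner, ← key f, ← key φ, hψ.inner_mfderiv]

theorem continuous_gradInner (g : RiemMetric n M) (f φ : SmoothFunction n M) :
    Continuous (gradInner g f φ) := by
  refine continuous_iff_continuousAt.2 fun x₀ => ?_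
  -- in a trivialization of the tangent bundle, `∇φ` is obtained from `dφ` by the inverse of the
  -- metric, and inversion is continuous
  let E := EuclideanSpace ℝ (Fin n)
  let T := trivializationAt E (TangentSpace (𝓡∂ n) : M → Type _) x₀
  have hA := ((contMDiffAt_hom_bundle _).1 (g.contMDiff x₀)).2.continuousAt
  have hB : ∀ f : SmoothFunction n M, ContinuousAt (inTangentCoordinates (𝓡∂ n) 𝓘(ℝ, ℝ) id f
      (mfderiv (𝓡∂ n) 𝓘(ℝ, ℝ) f) x₀ : M → E →L[ℝ] ℝ) x₀ := fun f =>
    ((f.contMDiff x₀).mfderiv_const (m := ∞) (by simp)).continuousAt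
  let A : M → E →L[ℝ] E →L[ℝ] ℝ := fun p => ContinuousLinearMap.inCoordinates E
    (TangentSpace (𝓡∂ n) : M → Type _) (E →L[ℝ] ℝ)
    (fun p : M => TangentSpace (𝓡∂ n) p →L[ℝ] ℝ) x₀ p x₀ p (g.inner p)
  let B : SmoothFunction n M → M → E →L[ℝ] ℝ := fun f =>
    inTangentCoordinates (𝓡∂ n) 𝓘(ℝ, ℝ) id f (mfderiv (𝓡∂ n) 𝓘(ℝ, ℝ) f) x₀
  have hAp : ∀ p ∈ T.baseSet, ∀ u v : E, A p u v = g.inner p (T.symm p u) (T.symm p v) := by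
    intro p hp u v
    have := inCoordinates_apply_eq₂ (𝕜 := ℝ) (F₁ := E) (F₂ := E) (F₃ := ℝ)
      (E₁ := fun p : M => TangentSpace (𝓡∂ n) p)
      (E₂ := fun p : M => TangentSpace (𝓡∂ n) p)
      (E₃ := fun _ => ℝ) (ϕ := g.inner p) (v := u) (w := v) hp hp (mem_univ _)
    refine this.trans ?_
    simp [T, E]
  have hBp : ∀ f : SmoothFunction n M, ∀ p ∈ T.baseSet, ∀ u : E,
      B f p u = mfderiv (𝓡∂ n) 𝓘(ℝ, ℝ) f p (T.symm p u) := by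
    intro f p hp u
    have h1 := ContinuousLinearMap.inCoordinates_eq (𝕜₁ := ℝ) (𝕜₂ := ℝ) (σ := RingHom.id ℝ)
      (F' := ℝ) (E' := (TangentSpace 𝓘(ℝ, ℝ) : ℝ → Type _)) (y₀ := f x₀) (y := f p)
      (ϕ := mfderiv (𝓡∂ n) 𝓘(ℝ, ℝ) f p) hp (mem_univ (f p))
    refine (congrArg (fun L : E →L[ℝ] ℝ => L u) h1).trans ?_
    have h2 := TangentBundle.continuousLinearMapAt_model_space (𝕜 := ℝ) (F := ℝ) (f x₀) (f p)
    refine (congrFun (Trivialization.coe_continuousLinearEquivAt_eq (R := ℝ)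
      (trivializationAt ℝ (TangentSpace 𝓘(ℝ, ℝ) : ℝ → Type _) (f x₀)) (mem_univ (f p)))
      (mfderiv (𝓡∂ n) 𝓘(ℝ, ℝ) f p (T.symm p u))).trans ?_
    exact congrArg (fun L : ℝ →L[ℝ] ℝ => L (mfderiv (𝓡∂ n) 𝓘(ℝ, ℝ) f p (T.symm p u))) h2
  have hT : ∀ p ∈ T.baseSet, ∀ v : TangentSpace (𝓡∂ n) p, ∃ u : E, T.symm p u = v := by
    intro p hp v
    exact ⟨T.continuousLinearEquivAt ℝ p hp v,
      (T.continuousLinearEquivAt ℝ p hp).symm_apply_apply v⟩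
  have hT0 : ∀ p ∈ T.baseSet, ∀ u : E, T.symm p u = 0 → u = 0 := by
    intro p hp u hu
    exact (T.continuousLinearEquivAt ℝ p hp).symm.map_eq_zero_iff.1 hu
  have hequiv : ∀ p ∈ T.baseSet, ∃ e : E ≃L[ℝ] (E →L[ℝ] ℝ), A p = e := by
    intro p hp
    have hinj : Function.Injective (A p) := by
      refine (injective_iff_map_eq_zero (A p)).2 fun u hu => hT0 p hp u ?_
      by_contra h0
      refine (g.pos p _ h0).ne' ?_
      rw [← hAp p hp, hu]
      rfl
    have hfr : Module.finrank ℝ E = Module.finrank ℝ (E →L[ℝ] ℝ) :=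
      (InnerProductSpace.toDual ℝ E).toLinearEquiv.finrank_eq
    exact ⟨(LinearEquiv.ofInjectiveOfFinrankEq (A p).toLinearMap hinj hfr).toContinuousLinearEquiv,
      rfl⟩
  have hev : (fun p => B f p ((A p).inverse (B φ p))) =ᶠ[𝓝 x₀] gradInner g f φ := by
    filter_upwards [T.open_baseSet.mem_nhds (FiberBundle.mem_baseSet_trivializationAt' x₀)]
      with p hp
    obtain ⟨e, he⟩ := hequiv p hp
    have hz : A p (e.symm (B φ p)) = B φ p := by
      rw [he]
      exact e.apply_symm_apply _
    have hgrad : riemannianGradient g φ p = T.symm p (e.symm (B φ p)) := by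
      refine riemannianGradient_eq_of_forall g fun v => ?_
      obtain ⟨u, rfl⟩ := hT p hp v
      rw [← hAp p hp, hz, hBp φ p hp]
    rw [he, ContinuousLinearMap.inverse_equiv, gradInner_eq_mfderiv, hgrad]
    exact hBp f p hp _
  refine ContinuousAt.congr ?_ hev
  obtain ⟨e, he⟩ := hequiv x₀ (FiberBundle.mem_baseSet_trivializationAt' x₀)
  have hinv : ContinuousAt (fun p => (A p).inverse) x₀ := by
    refine ContinuousAt.comp (g := ContinuousLinearMap.inverse) ?_ hA
    change ContinuousAt _ (A x₀)
    rw [he]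
    exact (contDiffAt_map_inverse (n := 1) e).continuousAt
  exact (hB f).clm_apply (hinv.clm_apply (hB φ))

end Gradient

/-! ### Translates, averages and lifts of smooth functions -/

section SmoothFunctions

variable {n : ℕ} [NeZero n] {M : Type*} [TopologicalSpace M] [T2Space M] [CompactSpace M]
  [ChartedSpace (EuclideanHalfSpace n) M] [IsManifold (𝓡∂ n) ∞ M]
  {Γ : Type*} [Group Γ] [MulAction Γ M] [ContinuousConstSMul Γ M]
  [SmoothConstSMul (𝓡∂ n) Γ M]

namespace SmoothFunction

/-- The function `x ↦ f (a • x)`. -/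
noncomputable def translate (a : Γ) (f : SmoothFunction n M) : SmoothFunction n M :=
  f.comp ⟨fun x => a • x, SmoothConstSMul.contMDiff_const_smul a⟩

theorem translate_apply (a : Γ) (f : SmoothFunction n M) (x : M) :
    translate a f x = f (a • x) := rfl

theorem translate_sub (a : Γ) (f h : SmoothFunction n M) :
    translate a (f - h) = translate a f - translate a h := rfl

/-- The average of a smooth function over the orbits of a finite group. -/
noncomputable def average (Γ : Type*) [Group Γ] [MulAction Γ M] [Fintype Γ]
    [SmoothConstSMul (𝓡∂ n) Γ M] (f : SmoothFunction n M) : SmoothFunction n M :=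
  (Fintype.card Γ : ℝ)⁻¹ • ∑ a : Γ, translate a f

theorem average_apply [Fintype Γ] (f : SmoothFunction n M) (x : M) :
    average Γ f x = orbitAverage Γ f x := by
  have h : ∀ t : Finset Γ, (∑ a ∈ t, translate a f : SmoothFunction n M) x =
      ∑ a ∈ t, f (a • x) := by
    classical
    intro t
    induction t using Finset.induction_on with
    | empty => rfl
    | insert i t hi ih =>
      rw [Finset.sum_insert hi, Finset.sum_insert hi, ← ih]
      rfl
  rw [average, orbitAverage, ← h]
  rfl

variable (n M) in
/-- The smooth functions with support in the interior. -/
def supportedInInterior : Submodule ℝ (SmoothFunction n M) where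
  carrier := {f | tsupport f ⊆ (𝓡∂ n).interior M}
  add_mem' {f h} hf hh := by
    refine (closure_mono (Function.support_add f h)).trans ?_
    rw [closure_union]
    exact union_subset hf hh
  zero_mem' := by
    change tsupport (0 : M → ℝ) ⊆ _
    rw [tsupport_zero]
    exact empty_subset _
  smul_mem' c f hf :=
    (closure_mono (Function.support_const_smul_subset c f)).trans hf

theorem translate_mem_supportedInInterior {g : RiemMetric n M} (hg : ActsByIsometries g Γ)
    (a : Γ) {f : SmoothFunction n M} (hf : f ∈ supportedInInterior n M) :
    translate a f ∈ supportedInInterior n M := by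
  refine (tsupport_comp_subset_preimage f (continuous_const_smul a)).trans fun x hx => ?_
  exact (hg.smul_mem_interior_iff a x).1 (hf hx)

variable [Finite Γ] [IsCancelSMul Γ M]

/-- The lift to `M` of a smooth function on `Γ \ M`. -/
noncomputable def lift (F : SmoothFunction n (MulAction.orbitRel.Quotient Γ M)) :
    SmoothFunction n M :=
  F.comp ⟨orbitMap Γ M, orbitMap_contMDiff⟩

theorem lift_apply (F : SmoothFunction n (MulAction.orbitRel.Quotient Γ M)) (x : M) :
    lift F x = F (orbitMap Γ M x) := rfl

theorem lift_sub (F K : SmoothFunction n (MulAction.orbitRel.Quotient Γ M)) :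
    lift (F - K) = lift F - lift K := rfl

/-- An invariant smooth function descends to the orbit manifold. -/
theorem exists_lift_eq (f : SmoothFunction n M) (hf : ∀ (a : Γ) x, f (a • x) = f x) :
    ∃ F : SmoothFunction n (MulAction.orbitRel.Quotient Γ M), lift F = f := by
  have hp : ∀ x, f (Quotient.out (orbitMap Γ M x)) = f x := by
    intro x
    obtain ⟨a, ha⟩ := orbitMap_eq_iff.1 (orbitMap_out (orbitMap Γ M x))
    rw [ha, hf]
  refine ⟨⟨fun q => f (Quotient.out q), fun q => ?_⟩, ?_⟩
  · have h1 : ContMDiffAt (𝓡∂ n) 𝓘(ℝ, ℝ) ∞ (f ∘ localSection Γ (Quotient.out q)) q :=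
      (f.contMDiff _).comp q (localSection_contMDiffAt (mem_localSection_out q))
    refine h1.congr_of_eventuallyEq ?_
    filter_upwards [(localSection Γ (Quotient.out q)).open_source.mem_nhds
      (mem_localSection_out q)] with y hy
    rw [Function.comp_apply, ← hp (localSection Γ (Quotient.out q) y), orbitMap_localSection hy]
  · ext x
    exact hp x

theorem exists_lift_eq_average [Fintype Γ] (f : SmoothFunction n M) :
    ∃ F : SmoothFunction n (MulAction.orbitRel.Quotient Γ M), lift F = average Γ f :=
  exists_lift_eq _ fun a x => by rw [average_apply, average_apply, orbitAverage_smul_point]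

theorem lift_mem_supportedInInterior_iff {g : RiemMetric n M} (hg : ActsByIsometries g Γ)
    (F : SmoothFunction n (MulAction.orbitRel.Quotient Γ M)) :
    lift F ∈ supportedInInterior n M ↔ F ∈ supportedInInterior n _ := by
  constructor
  · intro hF
    have hK : IsClosed (orbitMap Γ M '' tsupport (lift F)) :=
      ((isClosed_tsupport _).isCompact.image orbitMap_isLocalHomeomorph.continuous).isClosed
    refine (closure_minimal (fun q hq => ?_) hK).trans ?_
    · refine ⟨Quotient.out q, subset_tsupport _ ?_, orbitMap_out q⟩
      rw [Function.mem_support, lift_apply, orbitMap_out]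
      exact hq
    · rintro _ ⟨x, hx, rfl⟩
      exact (orbitMap_mem_interior_iff hg x).2 (hF hx)
  · intro hF
    refine (tsupport_comp_subset_preimage F orbitMap_isLocalHomeomorph.continuous).trans
      fun x hx => ?_
    exact (orbitMap_mem_interior_iff hg x).1 (hF hx)

end SmoothFunction

theorem SmoothFunction.aestronglyMeasurable (f : SmoothFunction n M) (μ : @Measure M (borel M)) :
    @AEStronglyMeasurable M ℝ _ (borel M) (borel M) f μ := by
  let : MeasurableSpace M := borel M
  have : BorelSpace M := ⟨rfl⟩
  exact f.contMDiff.continuous.aestronglyMeasurable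

theorem Continuous.memLp_of_compactSpace {f : M → ℝ} (hf : Continuous f)
    (μ : @Measure M (borel M)) [@IsFiniteMeasure M (borel M) μ] (q : ℝ≥0∞) : MemLp f q μ := by
  let : MeasurableSpace M := borel M
  have : BorelSpace M := ⟨rfl⟩
  obtain ⟨C, hC⟩ := isCompact_univ.exists_bound_of_continuousOn hf.continuousOn
  exact MemLp.of_bound hf.aestronglyMeasurable C (.of_forall fun x => hC x (mem_univ x))

theorem integrable_gradInner (g : RiemMetric n M) (f φ : SmoothFunction n M) :
    Integrable (gradInner g f φ) (volumeMeasure g) :=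
  memLp_one_iff_integrable.1 ((continuous_gradInner g f φ).memLp_of_compactSpace _ 1)

theorem integrable_mul_smooth (g : RiemMetric n M) (u : L2 g) (φ : SmoothFunction n M) :
    Integrable (fun x => u x * φ x) (volumeMeasure g) :=
  (Lp.memLp u).integrable_mul (φ.contMDiff.continuous.memLp_of_compactSpace _ 2)

theorem integrable_density_mul_smooth (g : RiemMetric n M) {ρ : M → ℝ}
    (hρ : MemLp ρ ∞ (boundaryMeasure g)) (w : L2Boundary g) (φ : SmoothFunction n M) :
    Integrable (fun x => ρ x * w x * φ x) (boundaryMeasure g) :=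
  (MemLp.mul (r := 2) (Lp.memLp w) hρ).integrable_mul
    (φ.contMDiff.continuous.memLp_of_compactSpace _ 2)

end SmoothFunctions

/-! ### Convergence in quadratic mean and in energy -/

section LpTranslation

variable {X G : Type*} [Group G] [MulAction G X] {mX : MeasurableSpace X} {μ : Measure X}

/-- The representation of a group on `L²` by translation of functions, for a measure preserving
action. -/
noncomputable def lpTranslation (h : ∀ a : G, MeasurePreserving (fun x : X => a • x) μ μ) :
    Representation ℝ G (Lp ℝ 2 μ) where
  toFun a := Lp.compMeasurePreservingₗ ℝ (fun x => a⁻¹ • x) (h a⁻¹)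
  map_one' := by
    ext1 u
    refine Lp.ext ((Lp.coeFn_compMeasurePreserving u (h 1⁻¹)).trans (.of_forall fun x => ?_))
    simp
  map_mul' a b := by
    ext1 u
    refine Lp.ext ((Lp.coeFn_compMeasurePreserving u (h (a * b)⁻¹)).trans ?_)
    refine EventuallyEq.symm ((Lp.coeFn_compMeasurePreserving _ (h a⁻¹)).trans ?_)
    filter_upwards [(h a⁻¹).quasiMeasurePreserving.ae
      (Lp.coeFn_compMeasurePreserving u (h b⁻¹))] with x hx
    rw [Function.comp_apply]
    refine hx.trans ?_
    simp [mul_smul]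

theorem coeFn_lpTranslation (h : ∀ a : G, MeasurePreserving (fun x : X => a • x) μ μ) (a : G)
    (u : Lp ℝ 2 μ) : lpTranslation h a u =ᵐ[μ] fun x => u (a⁻¹ • x) :=
  Lp.coeFn_compMeasurePreserving u (h a⁻¹)

/-- Convergence in quadratic mean. -/
def TendstoL2 (μ : Measure X) (f : ℕ → X → ℝ) (u : X → ℝ) : Prop :=
  Tendsto (fun k => eLpNorm (fun x => f k x - u x) 2 μ) atTop (𝓝 0)

theorem TendstoL2.congr_right {f : ℕ → X → ℝ} {u v : X → ℝ} (h : TendstoL2 μ f u)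
    (huv : u =ᵐ[μ] v) : TendstoL2 μ f v := by
  refine Tendsto.congr (fun k => eLpNorm_congr_ae ?_) h
  filter_upwards [huv] with x hx
  rw [hx]

theorem TendstoL2.add {f h : ℕ → X → ℝ} {u v : X → ℝ} (hf : TendstoL2 μ f u)
    (hh : TendstoL2 μ h v) (hfm : ∀ k, AEStronglyMeasurable (f k) μ)
    (hhm : ∀ k, AEStronglyMeasurable (h k) μ) (hu : AEStronglyMeasurable u μ)
    (hv : AEStronglyMeasurable v μ) : TendstoL2 μ (fun k x => f k x + h k x)
      fun x => u x + v x := by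
  have h0 := Tendsto.add hf hh
  rw [add_zero] at h0
  refine tendsto_of_tendsto_of_tendsto_of_le_of_le tendsto_const_nhds h0 (fun _ => bot_le)
    fun k => ?_
  have h1 : (fun x => f k x + h k x - (u x + v x)) =
      (fun x => f k x - u x) + fun x => h k x - v x := by
    ext x
    simp only [Pi.add_apply]
    ring
  simp only [h1]
  exact eLpNorm_add_le ((hfm k).sub hu) ((hhm k).sub hv) (by norm_num)

theorem TendstoL2.const_mul {f : ℕ → X → ℝ} {u : X → ℝ} (hf : TendstoL2 μ f u) (c : ℝ) :
    TendstoL2 μ (fun k x => c * f k x) fun x => c * u x := by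
  have h0 := ENNReal.Tendsto.const_mul (a := ‖c‖ₑ) hf (Or.inr enorm_ne_top)
  rw [mul_zero] at h0
  refine h0.congr fun k => ?_
  rw [← eLpNorm_const_smul]
  congr 1
  ext x
  simp [mul_sub]

theorem TendstoL2.comp_measurePreserving {f : ℕ → X → ℝ} {u : X → ℝ} (hf : TendstoL2 μ f u)
    {τ : X → X} (hτ : MeasurePreserving τ μ μ) (hfm : ∀ k, AEStronglyMeasurable (f k) μ)
    (hu : AEStronglyMeasurable u μ) :
    TendstoL2 μ (fun k x => f k (τ x)) fun x => u (τ x) :=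
  hf.congr fun k => (eLpNorm_comp_measurePreserving ((hfm k).sub hu) hτ).symm

theorem TendstoL2.zero : TendstoL2 μ (fun _ _ => 0) fun _ => 0 := by
  simp [TendstoL2]

theorem integral_comp_eq_of_measurePreserving {f : X → ℝ} {τ : X → X}
    (hτ : MeasurePreserving τ μ μ) (hf : AEStronglyMeasurable f μ) :
    ∫ x, f (τ x) ∂μ = ∫ x, f x ∂μ := by
  have h := integral_map (μ := μ) (φ := τ) hτ.measurable.aemeasurable (f := f)
    (by rw [hτ.map_eq]; exact hf)
  rw [← h, hτ.map_eq]

end LpTranslation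

section Energy

variable {n : ℕ} [NeZero n] {M : Type*} [TopologicalSpace M] [T2Space M] [CompactSpace M]
  [ChartedSpace (EuclideanHalfSpace n) M] [IsManifold (𝓡∂ n) ∞ M]

/-- The Dirichlet energy. -/
noncomputable def energy (g : RiemMetric n M) (f : SmoothFunction n M) : ℝ≥0∞ :=
  ∫⁻ x, ENNReal.ofReal (gradInner g f f x) ∂(volumeMeasure g)

theorem measurable_ofReal_gradInner (g : RiemMetric n M) (f : SmoothFunction n M) :
    @Measurable M ℝ≥0∞ (borel M) _ fun x => ENNReal.ofReal (gradInner g f f x) := by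
  let : MeasurableSpace M := borel M
  have : BorelSpace M := ⟨rfl⟩
  exact (continuous_gradInner g f f).measurable.ennreal_ofReal

theorem energy_add_le (g : RiemMetric n M) (f h : SmoothFunction n M) :
    energy g (f + h) ≤ 2 * energy g f + 2 * energy g h := by
  rw [energy, energy, energy, ← lintegral_const_mul _ (measurable_ofReal_gradInner g f),
    ← lintegral_const_mul _ (measurable_ofReal_gradInner g h),
    ← lintegral_add_left ((measurable_ofReal_gradInner g f).const_mul _)]
  refine lintegral_mono fun x => ?_
  have h2 : ∀ t : ℝ, 2 * ENNReal.ofReal t = ENNReal.ofReal (2 * t) := fun t => by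
    rw [ENNReal.ofReal_mul (by norm_num), ENNReal.ofReal_ofNat]
  rw [h2, h2, ← ENNReal.ofReal_add (mul_nonneg (by norm_num) (gradInner_self_nonneg g f x))
      (mul_nonneg (by norm_num) (gradInner_self_nonneg g h x))]
  exact ENNReal.ofReal_le_ofReal (gradInner_add_self_le g f h x)

theorem energy_smul (g : RiemMetric n M) (c : ℝ) (f : SmoothFunction n M) :
    energy g (c • f) = ENNReal.ofReal (c * c) * energy g f := by
  rw [energy, energy, ← lintegral_const_mul _ (measurable_ofReal_gradInner g f)]
  refine lintegral_congr fun x => ?_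
  rw [gradInner_smul_left, gradInner_smul_right, ← mul_assoc,
    ENNReal.ofReal_mul (mul_self_nonneg c)]

theorem energy_zero (g : RiemMetric n M) : energy g (0 : SmoothFunction n M) = 0 := by
  have := energy_smul g 0 (0 : SmoothFunction n M)
  simpa using this

/-- The sequence `f` is a Cauchy sequence for the Dirichlet energy. -/
def EnergyCauchy (g : RiemMetric n M) (f : ℕ → SmoothFunction n M) : Prop :=
  Tendsto (fun p : ℕ × ℕ => energy g (f p.1 - f p.2)) atTop (𝓝 0)

theorem EnergyCauchy.zero (g : RiemMetric n M) : EnergyCauchy g fun _ => 0 := by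
  simp [EnergyCauchy, energy_zero]

theorem EnergyCauchy.add {g : RiemMetric n M} {f h : ℕ → SmoothFunction n M}
    (hf : EnergyCauchy g f) (hh : EnergyCauchy g h) : EnergyCauchy g fun k => f k + h k := by
  have h0 := (ENNReal.Tendsto.const_mul (a := 2) hf (Or.inr (by simp))).add
    (ENNReal.Tendsto.const_mul (a := 2) hh (Or.inr (by simp)))
  rw [mul_zero, add_zero] at h0
  refine tendsto_of_tendsto_of_tendsto_of_le_of_le tendsto_const_nhds h0 (fun _ => bot_le)
    fun p => ?_
  simp only [add_sub_add_comm]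
  exact energy_add_le g _ _

theorem EnergyCauchy.const_smul {g : RiemMetric n M} {f : ℕ → SmoothFunction n M}
    (hf : EnergyCauchy g f) (c : ℝ) : EnergyCauchy g fun k => c • f k := by
  have h0 := ENNReal.Tendsto.const_mul (a := ENNReal.ofReal (c * c)) hf (Or.inr (by simp))
  rw [mul_zero] at h0
  refine h0.congr fun p => ?_
  rw [← energy_smul, smul_sub]

theorem EnergyCauchy.sum {g : RiemMetric n M} {ι : Type*} (t : Finset ι)
    {f : ι → ℕ → SmoothFunction n M} (hf : ∀ i, EnergyCauchy g (f i)) :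
    EnergyCauchy g fun k => ∑ i ∈ t, f i k := by
  classical
  induction t using Finset.induction_on with
  | empty => simpa using EnergyCauchy.zero g
  | insert i t hi ih => simpa only [Finset.sum_insert hi] using (hf i).add ih

variable {Γ : Type*} [Group Γ] [MulAction Γ M] [ContinuousConstSMul Γ M]
  [SmoothConstSMul (𝓡∂ n) Γ M] {g : RiemMetric n M}

open SmoothFunction

theorem gradInner_translate (hg : ActsByIsometries g Γ) (a : Γ) (f φ : SmoothFunction n M)
    (x : M) : gradInner g (translate a f) (translate a φ) x = gradInner g f φ (a • x) :=
  (hg.isLocalIsometry a).gradInner_comp f φ x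

theorem energy_translate (hg : ActsByIsometries g Γ) (a : Γ) (f : SmoothFunction n M) :
    energy g (translate a f) = energy g f := by
  let : MeasurableSpace M := borel M
  rw [energy, energy, ← (hg.measurePreserving_volume a).lintegral_comp
    (measurable_ofReal_gradInner g f)]
  simp only [gradInner_translate hg]

theorem integral_gradInner_translate (hg : ActsByIsometries g Γ) (a : Γ)
    (f φ : SmoothFunction n M) :
    ∫ x, gradInner g (translate a f) (translate a φ) x ∂(volumeMeasure g) =
      ∫ x, gradInner g f φ x ∂(volumeMeasure g) := by
  simp only [gradInner_translate hg]
  exact integral_comp_eq_of_measurePreserving (hg.measurePreserving_volume a)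
    (integrable_gradInner g f φ).1

theorem EnergyCauchy.translate (hg : ActsByIsometries g Γ) (a : Γ) {f : ℕ → SmoothFunction n M}
    (hf : EnergyCauchy g f) : EnergyCauchy g fun k => translate a (f k) :=
  hf.congr fun p => by rw [← translate_sub, energy_translate hg]

theorem EnergyCauchy.average [Fintype Γ] (hg : ActsByIsometries g Γ)
    {f : ℕ → SmoothFunction n M} (hf : EnergyCauchy g f) :
    EnergyCauchy g fun k => average Γ (f k) :=
  (EnergyCauchy.sum Finset.univ fun a => hf.translate hg a).const_smul _

variable [Finite Γ] [IsCancelSMul Γ M] {s : MulAction.orbitRel.Quotient Γ M → M}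

theorem gradInner_lift (hg : ActsByIsometries g Γ)
    (F Φ : SmoothFunction n (MulAction.orbitRel.Quotient Γ M)) (x : M) :
    gradInner g (lift F) (lift Φ) x = gradInner (quotientMetric g Γ hg) F Φ (orbitMap Γ M x) :=
  (isLocalIsometry_orbitMap hg).gradInner_comp F Φ x

theorem energyCauchy_lift_iff (hg : ActsByIsometries g Γ)
    (hq : IsFiniteMeasureQuotient Γ (orbitMap Γ M) s (volumeMeasure g)
      (volumeMeasure (quotientMetric g Γ hg)))
    (F : ℕ → SmoothFunction n (MulAction.orbitRel.Quotient Γ M)) :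
    EnergyCauchy g (fun k => lift (F k)) ↔ EnergyCauchy (quotientMetric g Γ hg) F := by
  have h : ∀ K : SmoothFunction n (MulAction.orbitRel.Quotient Γ M),
      energy g (lift K) = Nat.card Γ * energy (quotientMetric g Γ hg) K := by
    intro K
    rw [energy, energy, ← hq.lintegral_comp (measurable_ofReal_gradInner _ K)]
    simp only [gradInner_lift hg]
  simp only [EnergyCauchy, ← lift_sub, h]
  refine ⟨fun h0 => ?_, fun h0 => ?_⟩
  · refine tendsto_of_tendsto_of_tendsto_of_le_of_le tendsto_const_nhds h0 (fun _ => bot_le)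
      fun p => ?_
    exact le_mul_of_one_le_left' (by exact_mod_cast Nat.card_pos)
  · have h1 := ENNReal.Tendsto.const_mul (a := (Nat.card Γ : ℝ≥0∞)) h0 (Or.inr (by simp))
    rwa [mul_zero] at h1

/-- Averaging is adjoint to lifting for the Dirichlet form. -/
theorem integral_gradInner_lift (hg : ActsByIsometries g Γ) [Fintype Γ]
    (hq : IsFiniteMeasureQuotient Γ (orbitMap Γ M) s (volumeMeasure g)
      (volumeMeasure (quotientMetric g Γ hg)))
    (F Φ : SmoothFunction n (MulAction.orbitRel.Quotient Γ M)) (f : SmoothFunction n M)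
    (hF : lift F = average Γ f) :
    ∫ x, gradInner g f (lift Φ) x ∂(volumeMeasure g) =
      Nat.card Γ * ∫ q, gradInner (quotientMetric g Γ hg) F Φ q
        ∂(volumeMeasure (quotientMetric g Γ hg)) := by
  rw [← hq.integral_comp]
  simp only [← gradInner_lift hg, hF, SmoothFunction.average, gradInner_smul_left,
    gradInner_sum_left]
  rw [integral_const_mul, integral_finsetSum _ fun a _ => integrable_gradInner _ _ _]
  have h : ∀ a : Γ, ∫ x, gradInner g (SmoothFunction.translate a f) (lift Φ) x ∂(volumeMeasure g) =
      ∫ x, gradInner g f (lift Φ) x ∂(volumeMeasure g) := by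
    intro a
    have h1 : SmoothFunction.translate a (lift Φ) = lift Φ := by
      ext x
      rw [SmoothFunction.translate_apply, lift_apply, lift_apply, orbitMap_smul]
    rw [← integral_gradInner_translate hg a f, h1]
  simp only [h, Finset.sum_const, Finset.card_univ, nsmul_eq_mul]
  have : (Fintype.card Γ : ℝ) ≠ 0 := Nat.cast_ne_zero.2 Fintype.card_ne_zero
  field_simp

end Energy

/-! ### Spaces of weak solutions and the action of isometries -/

section WeakSolutions

open SmoothFunction

variable {n : ℕ} [NeZero n] {M : Type*} [TopologicalSpace M] [T2Space M] [CompactSpace M]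
  [ChartedSpace (EuclideanHalfSpace n) M] [IsManifold (𝓡∂ n) ∞ M] {g : RiemMetric n M}

theorem tendstoH1_iff {f : ℕ → SmoothFunction n M} {u : L2 g} :
    TendstoH1 g f u ↔ TendstoL2 (volumeMeasure g) (fun k => f k) u ∧ EnergyCauchy g f :=
  ⟨fun h => ⟨h.1, h.2⟩, fun h => ⟨h.1, h.2⟩⟩

theorem tendstoL2_zero (μ : @Measure M (borel M)) :
    TendstoL2 μ (fun _ => (0 : SmoothFunction n M)) (0 : Lp ℝ 2 μ) :=
  TendstoL2.zero.congr_right (Lp.coeFn_zero ℝ 2 μ).symm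

theorem TendstoL2.smooth_add {μ : @Measure M (borel M)} {f h : ℕ → SmoothFunction n M}
    {u v : Lp ℝ 2 μ} (hf : TendstoL2 μ (fun k => f k) u) (hh : TendstoL2 μ (fun k => h k) v) :
    TendstoL2 μ (fun k => (f k + h k : SmoothFunction n M)) (u + v : Lp ℝ 2 μ) :=
  (hf.add hh (fun k => (f k).aestronglyMeasurable μ) (fun k => (h k).aestronglyMeasurable μ)
    (Lp.aestronglyMeasurable u) (Lp.aestronglyMeasurable v)).congr_right (Lp.coeFn_add u v).symm

theorem TendstoL2.smooth_smul {μ : @Measure M (borel M)} {f : ℕ → SmoothFunction n M}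
    {u : Lp ℝ 2 μ} (hf : TendstoL2 μ (fun k => f k) u) (c : ℝ) :
    TendstoL2 μ (fun k => (c • f k : SmoothFunction n M)) (c • u : Lp ℝ 2 μ) :=
  (hf.const_mul c).congr_right (Lp.coeFn_smul c u).symm

theorem TendstoH1.zero : TendstoH1 g (fun _ => 0) 0 :=
  tendstoH1_iff.2 ⟨tendstoL2_zero _, EnergyCauchy.zero g⟩

theorem TendstoH1.add {f h : ℕ → SmoothFunction n M} {u v : L2 g} (hf : TendstoH1 g f u)
    (hh : TendstoH1 g h v) : TendstoH1 g (fun k => f k + h k) (u + v) := by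
  rw [tendstoH1_iff] at *
  exact ⟨hf.1.smooth_add hh.1, hf.2.add hh.2⟩

theorem TendstoH1.const_smul {f : ℕ → SmoothFunction n M} {u : L2 g} (hf : TendstoH1 g f u)
    (c : ℝ) : TendstoH1 g (fun k => c • f k) (c • u) := by
  rw [tendstoH1_iff] at *
  exact ⟨hf.1.smooth_smul c, hf.2.const_smul c⟩

theorem HasDirichletForm.zero (φ : SmoothFunction n M) : HasDirichletForm g 0 φ 0 := by
  refine ⟨_, TendstoH1.zero, ?_⟩
  have h : ∀ x, gradInner g (0 : SmoothFunction n M) φ x = 0 := fun x => by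
    have := gradInner_smul_left g 0 (0 : SmoothFunction n M) φ x
    simpa using this
  simp only [h, integral_zero]
  exact tendsto_const_nhds

theorem HasDirichletForm.add {u v : L2 g} {φ : SmoothFunction n M} {d e : ℝ}
    (hu : HasDirichletForm g u φ d) (hv : HasDirichletForm g v φ e) :
    HasDirichletForm g (u + v) φ (d + e) := by
  obtain ⟨f, hf, hfd⟩ := hu
  obtain ⟨h, hh, hhe⟩ := hv
  refine ⟨_, hf.add hh, (hfd.add hhe).congr fun k => ?_⟩
  rw [← integral_add (integrable_gradInner g _ _) (integrable_gradInner g _ _)]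
  simp only [gradInner_add_left]

theorem HasDirichletForm.const_smul {u : L2 g} {φ : SmoothFunction n M} {d : ℝ}
    (hu : HasDirichletForm g u φ d) (c : ℝ) : HasDirichletForm g (c • u) φ (c * d) := by
  obtain ⟨f, hf, hfd⟩ := hu
  refine ⟨_, hf.const_smul c, (hfd.const_mul c).congr fun k => ?_⟩
  rw [← integral_const_mul]
  simp only [gradInner_smul_left]

theorem integral_zero_mul_smooth (φ : SmoothFunction n M) :
    ∫ x, (0 : L2 g) x * φ x ∂(volumeMeasure g) = 0 := by
  refine integral_eq_zero_of_ae ?_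
  filter_upwards [Lp.coeFn_zero ℝ 2 (volumeMeasure g)] with x hx
  rw [hx, Pi.zero_apply, zero_mul]

theorem integral_add_mul_smooth (u v : L2 g) (φ : SmoothFunction n M) :
    ∫ x, (u + v : L2 g) x * φ x ∂(volumeMeasure g) =
      ∫ x, u x * φ x ∂(volumeMeasure g) + ∫ x, v x * φ x ∂(volumeMeasure g) := by
  rw [← integral_add (integrable_mul_smooth g u φ) (integrable_mul_smooth g v φ)]
  refine integral_congr_ae ?_
  filter_upwards [Lp.coeFn_add u v] with x hx
  rw [hx, Pi.add_apply, add_mul]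

theorem integral_smul_mul_smooth (c : ℝ) (u : L2 g) (φ : SmoothFunction n M) :
    ∫ x, (c • u : L2 g) x * φ x ∂(volumeMeasure g) = c * ∫ x, u x * φ x ∂(volumeMeasure g) := by
  rw [← integral_const_mul]
  refine integral_congr_ae ?_
  filter_upwards [Lp.coeFn_smul c u] with x hx
  rw [hx, Pi.smul_apply, smul_eq_mul, mul_assoc]

/-- The space of weak solutions of `Δu = μ u` in the closure in `H¹` of the space `S` of smooth
functions, tested against `S`. For the space of all smooth functions these are the Neumann
eigenfunctions, for the functions with support in the interior the Dirichlet eigenfunctions. -/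
def eigenspace (g : RiemMetric n M) (S : Submodule ℝ (SmoothFunction n M)) (μ : ℝ) :
    Submodule ℝ (L2 g) where
  carrier := {u | (∃ f : ℕ → SmoothFunction n M, (∀ k, f k ∈ S) ∧ TendstoH1 g f u) ∧
    ∀ φ ∈ S, HasDirichletForm g u φ (μ * ∫ x, u x * φ x ∂(volumeMeasure g))}
  zero_mem' := by
    refine ⟨⟨_, fun _ => S.zero_mem, TendstoH1.zero⟩, fun φ _ => ?_⟩
    rw [integral_zero_mul_smooth, mul_zero]
    exact HasDirichletForm.zero φ
  add_mem' := by
    rintro u v ⟨⟨f, hfS, hf⟩, hu⟩ ⟨⟨h, hhS, hh⟩, hv⟩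
    refine ⟨⟨_, fun k => S.add_mem (hfS k) (hhS k), hf.add hh⟩, fun φ hφ => ?_⟩
    rw [integral_add_mul_smooth, mul_add]
    exact (hu φ hφ).add (hv φ hφ)
  smul_mem' := by
    rintro c u ⟨⟨f, hfS, hf⟩, hu⟩
    refine ⟨⟨_, fun k => S.smul_mem c (hfS k), hf.const_smul c⟩, fun φ hφ => ?_⟩
    rw [integral_smul_mul_smooth, mul_left_comm]
    exact (hu φ hφ).const_smul c

theorem mem_eigenspace {S : Submodule ℝ (SmoothFunction n M)} {μ : ℝ} {u : L2 g} :
    u ∈ eigenspace g S μ ↔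
      (∃ f : ℕ → SmoothFunction n M, (∀ k, f k ∈ S) ∧ TendstoH1 g f u) ∧
        ∀ φ ∈ S, HasDirichletForm g u φ (μ * ∫ x, u x * φ x ∂(volumeMeasure g)) := Iff.rfl

theorem mem_eigenspace_top {μ : ℝ} {u : L2 g} : u ∈ eigenspace g ⊤ μ ↔ IsNeumannSolution g μ u := by
  simp [mem_eigenspace, IsNeumannSolution, MemH1]

theorem mem_eigenspace_supportedInInterior {μ : ℝ} {u : L2 g} :
    u ∈ eigenspace g (supportedInInterior n M) μ ↔ IsDirichletSolution g μ u := Iff.rfl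

/-- The space of solutions of the Steklov problem. The boundedness of `ρ` makes the boundary
integral additive in the trace. -/
def steklovSpace (g : RiemMetric n M) (α : ℝ) {ρ : M → ℝ} (hρ : MemLp ρ ∞ (boundaryMeasure g))
    (σ : ℝ) : Submodule ℝ (L2 g) where
  carrier := {u | IsSteklovSolution g α ρ σ u}
  zero_mem' := by
    refine ⟨0, ⟨_, TendstoH1.zero, tendstoL2_zero _⟩, fun φ => ?_⟩
    have h : ∫ x, ρ x * (0 : L2Boundary g) x * φ x ∂(boundaryMeasure g) = 0 := by
      refine integral_eq_zero_of_ae ?_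
      filter_upwards [Lp.coeFn_zero ℝ 2 (boundaryMeasure g)] with x hx
      rw [hx, Pi.zero_apply, mul_zero, zero_mul]
    rw [integral_zero_mul_smooth, h, mul_zero, mul_zero, add_zero]
    exact HasDirichletForm.zero φ
  add_mem' := by
    rintro u v ⟨w, ⟨f, hf, hfw⟩, hu⟩ ⟨z, ⟨h, hh, hhz⟩, hv⟩
    refine ⟨w + z, ⟨_, hf.add hh, TendstoL2.smooth_add hfw hhz⟩, fun φ => ?_⟩
    have h1 : ∫ x, ρ x * (w + z : L2Boundary g) x * φ x ∂(boundaryMeasure g) =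
        ∫ x, ρ x * w x * φ x ∂(boundaryMeasure g) + ∫ x, ρ x * z x * φ x ∂(boundaryMeasure g) := by
      rw [← integral_add (integrable_density_mul_smooth g hρ w φ)
        (integrable_density_mul_smooth g hρ z φ)]
      refine integral_congr_ae ?_
      filter_upwards [Lp.coeFn_add w z] with x hx
      rw [hx, Pi.add_apply]
      ring
    rw [integral_add_mul_smooth, h1, mul_add, mul_add, add_add_add_comm]
    exact (hu φ).add (hv φ)
  smul_mem' := by
    rintro c u ⟨w, ⟨f, hf, hfw⟩, hu⟩
    refine ⟨c • w, ⟨_, hf.const_smul c, TendstoL2.smooth_smul hfw c⟩, fun φ => ?_⟩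
    have h1 : ∫ x, ρ x * (c • w : L2Boundary g) x * φ x ∂(boundaryMeasure g) =
        c * ∫ x, ρ x * w x * φ x ∂(boundaryMeasure g) := by
      rw [← integral_const_mul]
      refine integral_congr_ae ?_
      filter_upwards [Lp.coeFn_smul c w] with x hx
      rw [hx, Pi.smul_apply, smul_eq_mul]
      ring
    rw [integral_smul_mul_smooth, h1, mul_left_comm α, mul_left_comm σ, ← mul_add]
    exact (hu φ).const_smul c

variable {Γ : Type*} [Group Γ] [MulAction Γ M] [ContinuousConstSMul Γ M]
  [SmoothConstSMul (𝓡∂ n) Γ M]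

/-- The action of the isometries on `L²(M)`. -/
noncomputable abbrev ActsByIsometries.volumeRep (hg : ActsByIsometries g Γ) :
    Representation ℝ Γ (L2 g) :=
  lpTranslation hg.measurePreserving_volume

/-- The action of the isometries on `L²(∂M)`. -/
noncomputable abbrev ActsByIsometries.boundaryRep (hg : ActsByIsometries g Γ) :
    Representation ℝ Γ (L2Boundary g) :=
  lpTranslation hg.measurePreserving_boundary

theorem TendstoL2.translate {μ : @Measure M (borel M)}
    (hμ : ∀ a : Γ, @MeasurePreserving M M (borel M) (borel M) (fun x : M => a • x) μ μ)
    {f : ℕ → SmoothFunction n M} {u : Lp ℝ 2 μ} (hf : TendstoL2 μ (fun k => f k) u) (a : Γ) :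
    TendstoL2 μ (fun k => SmoothFunction.translate a⁻¹ (f k)) (lpTranslation hμ a u) :=
  (hf.comp_measurePreserving (hμ a⁻¹) (fun k => (f k).aestronglyMeasurable μ)
    (Lp.aestronglyMeasurable u)).congr_right (coeFn_lpTranslation hμ a u).symm

theorem TendstoH1.translate (hg : ActsByIsometries g Γ) {f : ℕ → SmoothFunction n M} {u : L2 g}
    (hf : TendstoH1 g f u) (a : Γ) :
    TendstoH1 g (fun k => SmoothFunction.translate a⁻¹ (f k)) (hg.volumeRep a u) := by
  rw [tendstoH1_iff] at *
  exact ⟨hf.1.translate _ a, hf.2.translate hg a⁻¹⟩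

theorem HasDirichletForm.translate (hg : ActsByIsometries g Γ) {u : L2 g} (a : Γ)
    {φ : SmoothFunction n M} {d : ℝ}
    (hu : HasDirichletForm g u (SmoothFunction.translate a φ) d) :
    HasDirichletForm g (hg.volumeRep a u) φ d := by
  obtain ⟨f, hf, hfd⟩ := hu
  refine ⟨_, hf.translate hg a, hfd.congr fun k => ?_⟩
  have hφ : SmoothFunction.translate a⁻¹ (SmoothFunction.translate a φ) = φ := by
    ext x
    simp [SmoothFunction.translate_apply]
  rw [← integral_gradInner_translate hg a⁻¹, hφ]

/-- Translation of the solution amounts to the inverse translation of the test function. -/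
theorem integral_volumeRep_mul_smooth (hg : ActsByIsometries g Γ) (a : Γ) (u : L2 g)
    (φ : SmoothFunction n M) :
    ∫ x, hg.volumeRep a u x * φ x ∂(volumeMeasure g) =
      ∫ x, u x * SmoothFunction.translate a φ x ∂(volumeMeasure g) := by
  rw [← integral_comp_eq_of_measurePreserving (hg.measurePreserving_volume a⁻¹)
    (integrable_mul_smooth g u (SmoothFunction.translate a φ)).1]
  refine integral_congr_ae ?_
  filter_upwards [coeFn_lpTranslation hg.measurePreserving_volume a u] with x hx
  rw [hx, SmoothFunction.translate_apply, smul_inv_smul]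

theorem volumeRep_mem_eigenspace (hg : ActsByIsometries g Γ)
    {S : Submodule ℝ (SmoothFunction n M)}
    (hS : ∀ (a : Γ), ∀ φ ∈ S, SmoothFunction.translate a φ ∈ S) {μ : ℝ} (a : Γ) {u : L2 g}
    (hu : u ∈ eigenspace g S μ) : hg.volumeRep a u ∈ eigenspace g S μ := by
  obtain ⟨⟨f, hfS, hf⟩, hu⟩ := hu
  refine ⟨⟨_, fun k => hS _ _ (hfS k), hf.translate hg a⟩, fun φ hφ => ?_⟩
  rw [integral_volumeRep_mul_smooth]
  exact (hu _ (hS a φ hφ)).translate hg a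

theorem volumeRep_mem_steklovSpace (hg : ActsByIsometries g Γ) {α : ℝ} {ρ : M → ℝ}
    {hρ : MemLp ρ ∞ (boundaryMeasure g)}
    (hρ_inv : ∀ a : Γ, ∀ᵐ x ∂(boundaryMeasure g), ρ (a • x) = ρ x) {σ : ℝ} (a : Γ) {u : L2 g}
    (hu : u ∈ steklovSpace g α hρ σ) : hg.volumeRep a u ∈ steklovSpace g α hρ σ := by
  obtain ⟨w, ⟨f, hf, hfw⟩, hu⟩ := hu
  refine ⟨hg.boundaryRep a w, ⟨_, hf.translate hg a, TendstoL2.translate _ hfw a⟩, fun φ => ?_⟩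
  have h1 : ∫ x, ρ x * hg.boundaryRep a w x * φ x ∂(boundaryMeasure g) =
      ∫ x, ρ x * w x * SmoothFunction.translate a φ x ∂(boundaryMeasure g) := by
    rw [← integral_comp_eq_of_measurePreserving (hg.measurePreserving_boundary a⁻¹)
      (integrable_density_mul_smooth g hρ w (SmoothFunction.translate a φ)).1]
    refine integral_congr_ae ?_
    filter_upwards [coeFn_lpTranslation hg.measurePreserving_boundary a w, hρ_inv a⁻¹]
      with x hx hx2
    rw [hx, SmoothFunction.translate_apply, smul_inv_smul, hx2]
  rw [integral_volumeRep_mul_smooth, h1]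
  exact (hu (SmoothFunction.translate a φ)).translate hg a

end WeakSolutions

/-! ### Weak solutions on the orbit manifold -/

section Quotients

open SmoothFunction

variable {n : ℕ} [NeZero n] {M : Type*} [TopologicalSpace M] [T2Space M] [CompactSpace M]
  [ChartedSpace (EuclideanHalfSpace n) M] [IsManifold (𝓡∂ n) ∞ M] {g : RiemMetric n M}
  {Γ : Type*} [Group Γ] [MulAction Γ M] [ContinuousConstSMul Γ M]
  [SmoothConstSMul (𝓡∂ n) Γ M] [Finite Γ] [IsCancelSMul Γ M]
  {s : MulAction.orbitRel.Quotient Γ M → M} {hg : ActsByIsometries g Γ}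

theorem TendstoL2.lift {μ : @Measure M (borel M)}
    {ν : @Measure (MulAction.orbitRel.Quotient Γ M) (borel _)}
    (hq : IsFiniteMeasureQuotient Γ (orbitMap Γ M) s μ ν)
    {F : ℕ → SmoothFunction n (MulAction.orbitRel.Quotient Γ M)} {v : Lp ℝ 2 ν}
    (hF : TendstoL2 ν (fun k => F k) v) :
    TendstoL2 μ (fun k => SmoothFunction.lift (F k)) (hq.pullback v) :=
  TendstoL2.congr_right (hq.tendsto_eLpNorm_comp (fun k => (F k).aestronglyMeasurable ν)
    (Lp.aestronglyMeasurable v) hF) (hq.coeFn_pullback v).symm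

/-- Convergence in quadratic mean on `M` descends to the quotient after averaging. -/
theorem TendstoL2.descend [Fintype Γ] {μ : @Measure M (borel M)}
    {ν : @Measure (MulAction.orbitRel.Quotient Γ M) (borel _)}
    (hq : IsFiniteMeasureQuotient Γ (orbitMap Γ M) s μ ν)
    {F : ℕ → SmoothFunction n (MulAction.orbitRel.Quotient Γ M)} {f : ℕ → SmoothFunction n M}
    (hF : ∀ k, SmoothFunction.lift (F k) = average Γ (f k)) {w : Lp ℝ 2 μ} {v : Lp ℝ 2 ν}
    (hv : ∀ᵐ x ∂μ, v (orbitMap Γ M x) = orbitAverage Γ w x)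
    (hf : TendstoL2 μ (fun k => f k) w) : TendstoL2 ν (fun k => F k) v :=
  hq.tendsto_eLpNorm_of_orbitAverage (fun k => (f k).aestronglyMeasurable μ)
    (Lp.aestronglyMeasurable w)
    (fun k x => by rw [← average_apply, ← hF, SmoothFunction.lift_apply]) hv hf

/-- A pull-back is its own average. -/
theorem IsFiniteMeasureQuotient.comp_eq_orbitAverage_pullback {X Y : Type*} [MulAction Γ X]
    {mX : MeasurableSpace X} {mY : MeasurableSpace Y} {p : X → Y} {s : Y → X} {μ : Measure X}
    {ν : Measure Y} [Fintype Γ] (hq : IsFiniteMeasureQuotient Γ p s μ ν) (v : Lp ℝ 2 ν) :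
    ∀ᵐ x ∂μ, v (p x) = orbitAverage Γ (hq.pullback v) x := by
  filter_upwards [hq.coeFn_pullback v, ae_all_iff.2 (hq.smul_pullback_ae v)] with x hx hx'
  rw [orbitAverage_of_invariant hx', hx]

variable (hv : IsFiniteMeasureQuotient Γ (orbitMap Γ M) s (volumeMeasure g)
      (volumeMeasure (quotientMetric g Γ hg)))

theorem TendstoH1.lift {F : ℕ → SmoothFunction n (MulAction.orbitRel.Quotient Γ M)}
    {v : L2 (quotientMetric g Γ hg)} (hF : TendstoH1 (quotientMetric g Γ hg) F v) :
    TendstoH1 g (fun k => SmoothFunction.lift (F k)) (hv.pullback v) := by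
  rw [tendstoH1_iff] at *
  exact ⟨hF.1.lift hv, (energyCauchy_lift_iff hg hv F).2 hF.2⟩

/-- If `f k` converges in `H¹` to the pull-back of `v`, then the averages of `f k` descend to a
sequence that converges to `v` in `H¹` of the quotient. -/
theorem TendstoH1.descend [Fintype Γ]
    {F : ℕ → SmoothFunction n (MulAction.orbitRel.Quotient Γ M)} {f : ℕ → SmoothFunction n M}
    (hF : ∀ k, SmoothFunction.lift (F k) = average Γ (f k)) {v : L2 (quotientMetric g Γ hg)}
    (hf : TendstoH1 g f (hv.pullback v)) : TendstoH1 (quotientMetric g Γ hg) F v := by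
  rw [tendstoH1_iff] at *
  refine ⟨hf.1.descend hv hF (hv.comp_eq_orbitAverage_pullback v),
    (energyCauchy_lift_iff hg hv F).1 ?_⟩
  simp only [hF]
  exact hf.2.average hg

/-- The Dirichlet form of a pull-back with `φ` is the one on the quotient with the average of `φ`,
times the number of sheets. -/
theorem HasDirichletForm.lift [Fintype Γ] {v : L2 (quotientMetric g Γ hg)}
    {Φ : SmoothFunction n (MulAction.orbitRel.Quotient Γ M)} {φ : SmoothFunction n M}
    (hΦ : SmoothFunction.lift Φ = average Γ φ) {d : ℝ}
    (h : HasDirichletForm (quotientMetric g Γ hg) v Φ d) :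
    HasDirichletForm g (hv.pullback v) φ (Nat.card Γ * d) := by
  obtain ⟨F, hF, hFd⟩ := h
  refine ⟨_, hF.lift hv, (hFd.const_mul _).congr fun k => ?_⟩
  simp only [gradInner_comm _ _ φ, gradInner_comm _ _ Φ]
  exact (integral_gradInner_lift hg hv Φ (F k) φ hΦ).symm

theorem HasDirichletForm.descend [Fintype Γ] {v : L2 (quotientMetric g Γ hg)}
    {Φ : SmoothFunction n (MulAction.orbitRel.Quotient Γ M)} {d : ℝ}
    (h : HasDirichletForm g (hv.pullback v) (SmoothFunction.lift Φ) (Nat.card Γ * d)) :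
    HasDirichletForm (quotientMetric g Γ hg) v Φ d := by
  obtain ⟨f, hf, hfd⟩ := h
  choose F hF using fun k => exists_lift_eq_average (Γ := Γ) (f k)
  refine ⟨F, hf.descend hv hF, ?_⟩
  have hc : (Nat.card Γ : ℝ) ≠ 0 := Nat.cast_ne_zero.2 Nat.card_pos.ne'
  have := hfd.const_mul (Nat.card Γ : ℝ)⁻¹
  rw [inv_mul_cancel_left₀ hc] at this
  refine this.congr fun k => ?_
  rw [integral_gradInner_lift hg hv (F k) Φ (f k) (hF k), inv_mul_cancel_left₀ hc]

theorem integral_pullback_mul_lift (v : L2 (quotientMetric g Γ hg))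
    (Φ : SmoothFunction n (MulAction.orbitRel.Quotient Γ M)) :
    ∫ x, hv.pullback v x * lift Φ x ∂(volumeMeasure g) =
      Nat.card Γ * ∫ q, v q * Φ q ∂(volumeMeasure (quotientMetric g Γ hg)) := by
  rw [← hv.integral_comp]
  refine integral_congr_ae ?_
  filter_upwards [hv.coeFn_pullback v] with x hx
  rw [hx, lift_apply]

theorem integral_pullback_mul [Fintype Γ] (v : L2 (quotientMetric g Γ hg))
    {Φ : SmoothFunction n (MulAction.orbitRel.Quotient Γ M)} {φ : SmoothFunction n M}
    (hΦ : lift Φ = average Γ φ) :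
    ∫ x, hv.pullback v x * φ x ∂(volumeMeasure g) =
      Nat.card Γ * ∫ q, v q * Φ q ∂(volumeMeasure (quotientMetric g Γ hg)) := by
  have h : (fun x => hv.pullback v x * φ x) =ᵐ[volumeMeasure g]
      fun x => v (orbitMap Γ M x) * φ x := by
    filter_upwards [hv.coeFn_pullback v] with x hx
    rw [hx]
  rw [integral_congr_ae h]
  exact hv.integral_comp_mul v
    (.of_forall fun x => by rw [← average_apply, ← hΦ, lift_apply])
    ((integrable_congr h).1 (integrable_mul_smooth g _ φ))

/-- A function on the quotient is an eigenfunction if and only if its pull-back is one: lifts of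
test functions are test functions, and conversely test functions are averaged over the orbits. -/
theorem pullback_mem_eigenspace_iff {S : Submodule ℝ (SmoothFunction n M)}
    {T : Submodule ℝ (SmoothFunction n (MulAction.orbitRel.Quotient Γ M))}
    (hS : ∀ (a : Γ), ∀ φ ∈ S, SmoothFunction.translate a φ ∈ S)
    (hST : ∀ F : SmoothFunction n (MulAction.orbitRel.Quotient Γ M), lift F ∈ S ↔ F ∈ T)
    {μ : ℝ} {v : L2 (quotientMetric g Γ hg)} :
    hv.pullback v ∈ eigenspace g S μ ↔ v ∈ eigenspace (quotientMetric g Γ hg) T μ := by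
  have := Fintype.ofFinite Γ
  have hdesc : ∀ {F : SmoothFunction n (MulAction.orbitRel.Quotient Γ M)}
      {f : SmoothFunction n M}, lift F = average Γ f → f ∈ S → F ∈ T := by
    intro F f hF hf
    rw [← hST, hF]
    exact S.smul_mem _ (S.sum_mem fun a _ => hS a f hf)
  constructor
  · rintro ⟨⟨f, hfS, hf⟩, h⟩
    choose F hF using fun k => exists_lift_eq_average (Γ := Γ) (f k)
    refine ⟨⟨F, fun k => hdesc (hF k) (hfS k), hf.descend hv hF⟩, fun Φ hΦ => ?_⟩
    have h1 := h (lift Φ) ((hST Φ).2 hΦ)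
    rw [integral_pullback_mul_lift, mul_left_comm] at h1
    exact h1.descend hv
  · rintro ⟨⟨F, hFT, hF⟩, h⟩
    refine ⟨⟨_, fun k => (hST _).2 (hFT k), hF.lift hv⟩, fun φ hφ => ?_⟩
    obtain ⟨Φ, hΦ⟩ := exists_lift_eq_average (Γ := Γ) φ
    rw [integral_pullback_mul hv v hΦ, mul_left_comm]
    exact (h Φ (hdesc hΦ hφ)).lift hv hΦ

theorem inducedFunction_orbitMap_ae {ρ : M → ℝ} {μ : @Measure M (borel M)}
    (hρ : ∀ a : Γ, ∀ᵐ x ∂μ, ρ (a • x) = ρ x) :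
    ∀ᵐ x ∂μ, inducedFunction Γ ρ (orbitMap Γ M x) = ρ x := by
  filter_upwards [ae_all_iff.2 hρ] with x hx
  obtain ⟨a, ha⟩ := orbitMap_eq_iff.1 (orbitMap_out (orbitMap Γ M x))
  rw [inducedFunction, ha, hx]

/-- A function on the quotient solves the Steklov problem if and only if its pull-back does. The
trace of a pull-back is the pull-back of the trace; conversely, the average of the trace of a
pull-back is the trace on the quotient. -/
theorem pullback_mem_steklovSpace_iff
    (hb : IsFiniteMeasureQuotient Γ (orbitMap Γ M) s (boundaryMeasure g)
      (boundaryMeasure (quotientMetric g Γ hg))) {ρ : M → ℝ}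
    {hρ : MemLp ρ ∞ (boundaryMeasure g)}
    (hρ_inv : ∀ a : Γ, ∀ᵐ x ∂(boundaryMeasure g), ρ (a • x) = ρ x) {α σ : ℝ}
    {v : L2 (quotientMetric g Γ hg)} :
    hv.pullback v ∈ steklovSpace g α hρ σ ↔
      IsSteklovSolution (quotientMetric g Γ hg) α (inducedFunction Γ ρ) σ v := by
  have := Fintype.ofFinite Γ
  have hρ' := inducedFunction_orbitMap_ae hρ_inv
  have hfac : ∀ A B : ℝ, α * (Nat.card Γ * A) + σ * (Nat.card Γ * B) =
      Nat.card Γ * (α * A + σ * B) := fun A B => by ring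
  constructor
  · rintro ⟨w, ⟨f, hf, hfw⟩, h⟩
    obtain ⟨z, hz⟩ := hb.exists_comp_eq_orbitAverage w
    choose F hF using fun k => exists_lift_eq_average (Γ := Γ) (f k)
    refine ⟨z, ⟨F, hf.descend hv hF, TendstoL2.descend hb hF hz hfw⟩, fun Φ => ?_⟩
    have h1 : (fun x => ρ x * w x * lift Φ x) =ᵐ[boundaryMeasure g] fun x =>
        inducedFunction Γ ρ (orbitMap Γ M x) * Φ (orbitMap Γ M x) * w x := by
      filter_upwards [hρ'] with x hx
      rw [hx, lift_apply]
      ring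
    have h2 := hb.integral_comp_mul (fun q => inducedFunction Γ ρ q * Φ q) hz
      ((integrable_congr h1).1 (integrable_density_mul_smooth g hρ w (lift Φ)))
    have h3 := h (lift Φ)
    rw [integral_pullback_mul_lift, integral_congr_ae h1, h2, hfac] at h3
    simp only [mul_right_comm _ (Φ _)] at h3
    exact h3.descend hv
  · rintro ⟨w, ⟨F, hF, hFw⟩, h⟩
    refine ⟨hb.pullback w, ⟨_, hF.lift hv, TendstoL2.lift hb hFw⟩, fun φ => ?_⟩
    obtain ⟨Φ, hΦ⟩ := exists_lift_eq_average (Γ := Γ) φ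
    have h1 : (fun x => ρ x * hb.pullback w x * φ x) =ᵐ[boundaryMeasure g] fun x =>
        inducedFunction Γ ρ (orbitMap Γ M x) * w (orbitMap Γ M x) * φ x := by
      filter_upwards [hρ', hb.coeFn_pullback w] with x hx hx'
      rw [hx, hx']
    have h2 := hb.integral_comp_mul (fun q => inducedFunction Γ ρ q * w q)
      (f := φ) (F := Φ) (.of_forall fun x => by rw [← average_apply, ← hΦ, lift_apply])
      ((integrable_congr h1).1 (integrable_density_mul_smooth g hρ _ φ))
    rw [integral_pullback_mul hv v hΦ, integral_congr_ae h1, h2, hfac]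
    exact (h Φ).lift hv hΦ

end Quotients

/-! ### Multiplicities on the quotients by almost conjugate subgroups -/

section Multiplicities

variable {n : ℕ} [NeZero n] {M : Type*} [TopologicalSpace M] [T2Space M] [CompactSpace M]
  [ChartedSpace (EuclideanHalfSpace n) M] [IsManifold (𝓡∂ n) ∞ M] {g : RiemMetric n M}
  {G : Type*} [Group G] [Finite G] [MulAction G M] [ContinuousConstSMul G M]
  [SmoothConstSMul (𝓡∂ n) G M]

/-- The functions on the quotient by a subgroup `S` whose pull-backs are in an invariant space `V`
correspond to the vectors of `V` that are fixed by `S`. -/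
theorem rank_comap_pullback (hg : ActsByIsometries g G) (S : Subgroup G) [IsCancelSMul S M]
    {s : MulAction.orbitRel.Quotient S M → M}
    (hv : IsFiniteMeasureQuotient S (orbitMap S M) s (volumeMeasure g)
      (volumeMeasure (quotientMetric g S (hg.subgroup S))))
    (V : Submodule ℝ (L2 g)) (hV : ∀ a, V ≤ V.comap (hg.volumeRep a)) :
    Module.rank ℝ (V.comap hv.pullback) =
      Module.rank ℝ (fixedVectors (hg.volumeRep.subrepresentation V hV) S) := by
  let f : V.comap hv.pullback →ₗ[ℝ] V := hv.pullback.restrict fun _ hu => hu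
  have hf : Function.Injective f := fun u v huv =>
    Subtype.ext (hv.pullback_injective (congrArg Subtype.val huv))
  have hr : LinearMap.range f = fixedVectors (hg.volumeRep.subrepresentation V hV) S := by
    ext w
    rw [LinearMap.mem_range, mem_fixedVectors]
    constructor
    · rintro ⟨v, rfl⟩ a ha
      refine Subtype.ext (Lp.ext ?_)
      exact (coeFn_lpTranslation hg.measurePreserving_volume a _).trans
        (hv.smul_pullback_ae v.1 ⟨a⁻¹, S.inv_mem ha⟩)
    · intro hw
      obtain ⟨v, hvw⟩ := hv.exists_pullback_eq w.1 fun a => by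
        have h1 := coeFn_lpTranslation hg.measurePreserving_volume (a : G)⁻¹ w.1
        have h2 := congrArg Subtype.val (hw _ (S.inv_mem a.2))
        change hg.volumeRep (a : G)⁻¹ w.1 = w.1 at h2
        rw [h2] at h1
        filter_upwards [h1] with x hx
        rw [hx, inv_inv]
        rfl
      refine ⟨⟨v, ?_⟩, Subtype.ext hvw⟩
      rw [Submodule.mem_comap, hvw]
      exact w.2
  rw [← hr]
  exact (LinearEquiv.ofInjective f hf).rank_eq

/-- If two sets of functions on the quotients by almost conjugate subgroups consist of the functions
whose pull-backs are in one and the same invariant space, then they have the same dimension. -/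
theorem rank_span_eq_of_pullback_mem_iff (hg : ActsByIsometries g G) {S S' : Subgroup G}
    (hSS' : AlmostConjugate S S') [IsCancelSMul S M] [IsCancelSMul S' M]
    {s : MulAction.orbitRel.Quotient S M → M} {s' : MulAction.orbitRel.Quotient S' M → M}
    (hv : IsFiniteMeasureQuotient S (orbitMap S M) s (volumeMeasure g)
      (volumeMeasure (quotientMetric g S (hg.subgroup S))))
    (hv' : IsFiniteMeasureQuotient S' (orbitMap S' M) s' (volumeMeasure g)
      (volumeMeasure (quotientMetric g S' (hg.subgroup S'))))
    (V : Submodule ℝ (L2 g)) (hV : ∀ a, V ≤ V.comap (hg.volumeRep a))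
    {P : L2 (quotientMetric g S (hg.subgroup S)) → Prop}
    {P' : L2 (quotientMetric g S' (hg.subgroup S')) → Prop}
    (hP : ∀ v, hv.pullback v ∈ V ↔ P v) (hP' : ∀ v, hv'.pullback v ∈ V ↔ P' v) :
    ((∃ v, v ≠ 0 ∧ P v) ↔ ∃ v, v ≠ 0 ∧ P' v) ∧
      Module.rank ℝ (Submodule.span ℝ {v | P v}) =
        Module.rank ℝ (Submodule.span ℝ {v | P' v}) := by
  have hr : Module.rank ℝ (V.comap hv.pullback) = Module.rank ℝ (V.comap hv'.pullback) := by
    rw [rank_comap_pullback hg S hv V hV, rank_comap_pullback hg S' hv' V hV]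
    exact rank_fixedVectors_eq _ hSS'
  have e : {v | P v} = (V.comap hv.pullback : Set _) := Set.ext fun v => (hP v).symm
  have e' : {v | P' v} = (V.comap hv'.pullback : Set _) := Set.ext fun v => (hP' v).symm
  refine ⟨?_, by rw [e, e', Submodule.span_eq, Submodule.span_eq, hr]⟩
  have h1 : (∃ v, v ≠ 0 ∧ P v) ↔ V.comap hv.pullback ≠ ⊥ := by
    rw [Submodule.ne_bot_iff]
    exact exists_congr fun v => by rw [← hP, and_comm, Submodule.mem_comap]
  have h2 : (∃ v, v ≠ 0 ∧ P' v) ↔ V.comap hv'.pullback ≠ ⊥ := by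
    rw [Submodule.ne_bot_iff]
    exact exists_congr fun v => by rw [← hP', and_comm, Submodule.mem_comap]
  rw [h1, h2, ne_eq, ne_eq, ← Submodule.rank_eq_zero, ← Submodule.rank_eq_zero, hr]

end Multiplicities

theorem mainTheorem1 {n : ℕ} [NeZero n] {M : Type*} [TopologicalSpace M] [T2Space M]
    [CompactSpace M] [ChartedSpace (EuclideanHalfSpace n) M] [IsManifold (𝓡∂ n) ∞ M]
    (g : ContMDiffRiemannianMetric (𝓡∂ n) ∞ (EuclideanSpace ℝ (Fin n))
      (fun x : M => TangentSpace (𝓡∂ n) x))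
    {G : Type*} [Group G] [Finite G] [MulAction G M] [ContinuousConstSMul G M]
    [SmoothConstSMul (𝓡∂ n) G M] (hg : ActsByIsometries g G)
    (H H' : Subgroup G) (hHH' : AlmostConjugate H H')
    [IsCancelSMul H M] [IsCancelSMul H' M]
    (ρ : M → ℝ) (hρ : MemLp ρ ∞ (boundaryMeasure g))
    (hρ_nonneg : ∀ᵐ x ∂(boundaryMeasure g), 0 ≤ ρ x)
    (hρ_inv : ∀ a : G, ∀ᵐ x ∂(boundaryMeasure g), ρ (a • x) = ρ x) :
    (dirichletSpectrum (quotientMetric g H (hg.subgroup H)) =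
        dirichletSpectrum (quotientMetric g H' (hg.subgroup H')) ∧
      ∀ μ : ℝ, dirichletMultiplicity (quotientMetric g H (hg.subgroup H)) μ =
        dirichletMultiplicity (quotientMetric g H' (hg.subgroup H')) μ) ∧
    (neumannSpectrum (quotientMetric g H (hg.subgroup H)) =
        neumannSpectrum (quotientMetric g H' (hg.subgroup H')) ∧
      ∀ μ : ℝ, neumannMultiplicity (quotientMetric g H (hg.subgroup H)) μ =
        neumannMultiplicity (quotientMetric g H' (hg.subgroup H')) μ) ∧
    ∀ α : ℝ, α ∉ dirichletSpectrum (quotientMetric g H (hg.subgroup H)) →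
      α ∉ dirichletSpectrum (quotientMetric g H' (hg.subgroup H')) →
      steklovSpectrum (quotientMetric g H (hg.subgroup H)) α (inducedFunction H ρ) =
        steklovSpectrum (quotientMetric g H' (hg.subgroup H')) α (inducedFunction H' ρ) ∧
      ∀ σ : ℝ, steklovMultiplicity (quotientMetric g H (hg.subgroup H)) α (inducedFunction H ρ) σ =
        steklovMultiplicity (quotientMetric g H' (hg.subgroup H')) α (inducedFunction H' ρ) σ := by
  obtain ⟨s, hv, hb⟩ := exists_isFiniteMeasureQuotient (hg.subgroup H)
  obtain ⟨s', hv', hb'⟩ := exists_isFiniteMeasureQuotient (hg.subgroup H')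
  have hD (μ : ℝ) := rank_span_eq_of_pullback_mem_iff hg hHH' hv hv'
    (eigenspace g (SmoothFunction.supportedInInterior n M) μ)
    (fun a _ hu => volumeRep_mem_eigenspace hg
      (fun a _ => SmoothFunction.translate_mem_supportedInInterior hg a) a hu)
    (fun _ => (pullback_mem_eigenspace_iff hv
      (fun a _ => SmoothFunction.translate_mem_supportedInInterior (hg.subgroup H) a)
      (SmoothFunction.lift_mem_supportedInInterior_iff (hg.subgroup H))).trans
        mem_eigenspace_supportedInInterior)
    (fun _ => (pullback_mem_eigenspace_iff hv'
      (fun a _ => SmoothFunction.translate_mem_supportedInInterior (hg.subgroup H') a)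
      (SmoothFunction.lift_mem_supportedInInterior_iff (hg.subgroup H'))).trans
        mem_eigenspace_supportedInInterior)
  have hN (μ : ℝ) := rank_span_eq_of_pullback_mem_iff hg hHH' hv hv' (eigenspace g ⊤ μ)
    (fun a _ hu => volumeRep_mem_eigenspace hg (fun _ _ _ => Submodule.mem_top) a hu)
    (fun _ => (pullback_mem_eigenspace_iff hv (fun _ _ _ => Submodule.mem_top)
      (fun _ => by simp)).trans mem_eigenspace_top)
    (fun _ => (pullback_mem_eigenspace_iff hv' (fun _ _ _ => Submodule.mem_top)
      (fun _ => by simp)).trans mem_eigenspace_top)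
  have hSt (α σ : ℝ) := rank_span_eq_of_pullback_mem_iff hg hHH' hv hv' (steklovSpace g α hρ σ)
    (fun a _ hu => volumeRep_mem_steklovSpace hg hρ_inv a hu)
    (fun _ => pullback_mem_steklovSpace_iff hv hb fun a => hρ_inv a)
    (fun _ => pullback_mem_steklovSpace_iff hv' hb' fun a => hρ_inv a)
  exact ⟨⟨Set.ext fun μ => (hD μ).1, fun μ => (hD μ).2⟩,
    ⟨Set.ext fun μ => (hN μ).1, fun μ => (hN μ).2⟩,
    fun α _ _ => ⟨Set.ext fun σ => (hSt α σ).1, fun σ => (hSt α σ).2⟩⟩
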